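/- **Theorem 6.2.** Normalize the Fourier transform by $\hat f(\xi)=\int f(x)e^{-2\pi i x\cdot\xi}\,dx$. Let $\nu:\mathbb{R}\to\mathbb{R}$ be an even $C^\infty$ function supported in $[-\tfrac12,\tfrac12]$ with $\nu(\theta)^2+\nu(\theta-\tfrac12)^2=1$ for $\theta\in[0,\tfrac12]$, let $w:\mathbb{R}\to\mathbb{R}$ be a $C^\infty$ function supported in $[\tfrac13,\tfrac83]$, and let $\chi_0:\mathbb{R}^2\to\mathbb{R}$ be an even measurable function supported in a disk centred at the origin. For $j\ge 1$ and $0\le \ell<2^j$ put $$\chi_{j,\ell}(\xi)=w(2^{-2j}|\xi|)\,\bigl(\nu_{j,\ell}(\theta)+\nu_{j,\ell}(\theta+\tfrac12)\bigr),$$ where $2\pi\theta$ is the polar angle of $\xi$ and $\nu_{j,\ell}(\theta)=\sum_{m\in\mathbb{Z}}\nu\bigl(2^j(\theta+m)-\tfrac{\ell}{2}\bigr)$ is the $1$-periodic version of $\nu(2^j\theta-\tfrac{\ell}{2})$; put also $\chi_{0,0}=\chi_0$. Assume that these windows tile the frequency plane: $$\sum_{j\ge 0}\sum_{\ell=0}^{2^j-1}\chi_{j,\ell}(\xi)^2=1\qquad\text{for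 all }\xi\in\mathbb{R}^2 .$$ Let $\gamma_j$ be the inverse Fourier transform of $2^{-3j/2-5/2}\chi_{j,0}$. For $\alpha=(\alpha_1,\alpha_2)$ with $\alpha_1,\alpha_2>0$ let $\Gamma^\alpha=\{\gamma^\alpha_{j,\ell,k}\}$, $j\ge 0$, $0\le\ell<2^j$, $k\in\mathbb{Z}^2$, be the oversampled curvelet system $$\gamma^\alpha_{j,0,k}(x)=\gamma_j\bigl(x_1-2^{-2j}\alpha_1k_1,\;x_2-2^{-j}\alpha_2k_2\bigr),\qquad \gamma^\alpha_{j,\ell,k}(x)=\gamma^\alpha_{j,0,k}\bigl(R_{\theta_{j,\ell}}^{*}x\bigr),$$ where $R_t$ is the rotation by $t$ and $\theta_{j,\ell}=2^{-j}\pi\ell$. If $\alpha_1\le 3\cdot 2^{-5}$ and $\alpha_2\le \frac{9}{20\pi}$, then $\Gamma^\alpha$ does sign retrieval. That is, the functions $\gamma^\alpha_{j,\ell,k}$ are real-valued, and whenever $f,h\in L^2(\mathbb{R}^2)$ are real-valued and exponentially decaying (meaning $\int|f(x)|e^{c|x|}dx<\infty$ for some $c>0$, and likewise for $h$ with a possibly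 different $c>0$) and satisfy $|\langle f,\gamma^\alpha_{j,\ell,k}\rangle|=|\langle h,\gamma^\alpha_{j,\ell,k}\rangle|$ for all $j,\ell,k$, then $f=h$ or $f=-h$ almost everywhere. -/

import Mathlib

open MeasureTheory
open scoped ContDiff FourierTransform ComplexConjugate

noncomputable section

namespace SignRetrieval

/-- Exponential decay at infinity: `∫ |f(x)| e^{c|x|} dx < ∞` for some `c > 0`, with `|x|` the
Euclidean norm. -/
def ExpDecay {d : ℕ} (f : EuclideanSpace ℝ (Fin d) → ℝ) : Prop :=
  ∃ c : ℝ, 0 < c ∧ Integrable (fun x => |f x| * Real.exp (c * ‖x‖)) volume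

/-- The coefficient `⟨f, φ⟩ = ∫ f(x) conj(φ(x)) dx` of a real function. -/
def coeff {d : ℕ} (f : EuclideanSpace ℝ (Fin d) → ℝ) (φ : EuclideanSpace ℝ (Fin d) → ℂ) : ℂ :=
  ∫ x, (f x : ℂ) * conj (φ x)

/-- A system `φ` of real-valued functions does sign retrieval if the unsigned coefficients
`|⟨f, φ i⟩|` determine `f` up to a global sign, for `f` in the class of real-valued exponentially
decaying functions in `L²(ℝᵈ)`. The functions `φ i` are typed as complex functions (they arise as
inverse Fourier transforms); that they are real-valued is part of the claim. -/
def DoesSignRetrieval {d : ℕ} {ι : Type*} (φ : ι → EuclideanSpace ℝ (Fin d) → ℂ) : Prop :=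
  (∀ i x, (φ i x).im = 0) ∧
  ∀ f h : EuclideanSpace ℝ (Fin d) → ℝ,
    MemLp f 2 volume → ExpDecay f → MemLp h 2 volume → ExpDecay h →
    (∀ i, ‖coeff f (φ i)‖ = ‖coeff h (φ i)‖) →
    f =ᵐ[volume] h ∨ f =ᵐ[volume] (fun x => -h x)

/-- The polar angle of `ξ ∈ ℝ²`, measured in full turns. -/
def turn (ξ : EuclideanSpace ℝ (Fin 2)) : ℝ :=
  Complex.arg ⟨ξ 0, ξ 1⟩ / (2 * Real.pi)

/-- The angular window `ν_{j,ℓ}(θ) = ν(2^j θ - ℓ/2)`, as a function of an angle in turns, that is,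
made 1-periodic in `θ` (for `ν` supported in `[-1/2,1/2]` the sum has finitely many nonzero
terms). -/
def angularWindow (ν : ℝ → ℝ) (j ℓ : ℕ) (θ : ℝ) : ℝ :=
  ∑' m : ℤ, ν (2 ^ j * (θ + m) - ℓ / 2)

/-- The frequency windows: the low-frequency window `χ₀` for `j = 0`, and
`χ_{j,ℓ}(ξ) = w(2^{-2j}|ξ|) (ν_{j,ℓ}(θ) + ν_{j,ℓ}(θ + 1/2))` for `j ≥ 1`. -/
def window (ν w : ℝ → ℝ) (χ₀ : EuclideanSpace ℝ (Fin 2) → ℝ) (j ℓ : ℕ)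
    (ξ : EuclideanSpace ℝ (Fin 2)) : ℝ :=
  if j = 0 then χ₀ ξ
  else w (‖ξ‖ / 2 ^ (2 * j)) *
    (angularWindow ν j ℓ (turn ξ) + angularWindow ν j ℓ (turn ξ + 1 / 2))

/-- Admissible generating windows `ν`, `w`, `χ₀` of the second-generation curvelets. -/
structure IsCurveletTriple (ν w : ℝ → ℝ) (χ₀ : EuclideanSpace ℝ (Fin 2) → ℝ) : Prop where
  nu_smooth : ContDiff ℝ ∞ ν
  nu_even : ∀ θ, ν (-θ) = ν θ
  nu_support : Function.support ν ⊆ Set.Icc (-(1 / 2)) (1 / 2)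
  nu_partition : ∀ θ ∈ Set.Icc (0 : ℝ) (1 / 2), ν θ ^ 2 + ν (θ - 1 / 2) ^ 2 = 1
  w_smooth : ContDiff ℝ ∞ w
  w_support : Function.support w ⊆ Set.Icc (1 / 3) (8 / 3)
  low_measurable : Measurable χ₀
  low_even : ∀ ξ, χ₀ (-ξ) = χ₀ ξ
  low_support : ∃ r : ℝ, Function.support χ₀ ⊆ Metric.closedBall 0 r
  /-- The squared windows tile the frequency plane. -/
  tiling : ∀ ξ, HasSum (fun j : ℕ => ∑ ℓ ∈ Finset.range (2 ^ j), window ν w χ₀ j ℓ ξ ^ 2) 1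

/-- `γ_j`, the inverse Fourier transform (with kernel `e^{2πi x·ξ}`) of
`2^{-3j/2-5/2} χ_{j,0}`. -/
def generator (ν w : ℝ → ℝ) (χ₀ : EuclideanSpace ℝ (Fin 2) → ℝ) (j : ℕ) :
    EuclideanSpace ℝ (Fin 2) → ℂ :=
  𝓕⁻ (fun ξ : EuclideanSpace ℝ (Fin 2) =>
    (((2 : ℝ) ^ (-(3 * (j : ℝ) / 2) - 5 / 2) * window ν w χ₀ j 0 ξ : ℝ) : ℂ))

/-- `R_t^*`, the transpose of the counterclockwise rotation `R_t` by the angle `t`. -/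
def rotT (t : ℝ) (x : EuclideanSpace ℝ (Fin 2)) : EuclideanSpace ℝ (Fin 2) :=
  !₂[Real.cos t * x 0 + Real.sin t * x 1, -Real.sin t * x 0 + Real.cos t * x 1]

/-- `γ^α_{j,0,k}(x) = γ_j(x₁ - 2^{-2j} α₁ k₁, x₂ - 2^{-j} α₂ k₂)`. -/
def curveletZero (ν w : ℝ → ℝ) (χ₀ : EuclideanSpace ℝ (Fin 2) → ℝ) (α₁ α₂ : ℝ)
    (j : ℕ) (k₁ k₂ : ℤ) (x : EuclideanSpace ℝ (Fin 2)) : ℂ :=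
  generator ν w χ₀ j !₂[x 0 - α₁ * k₁ / 2 ^ (2 * j), x 1 - α₂ * k₂ / 2 ^ j]

/-- The system `Γ^α` of all `γ^α_{j,ℓ,k}(x) = γ^α_{j,0,k}(R_{θ_{j,ℓ}}^* x)` with
`θ_{j,ℓ} = 2^{-j} π ℓ`, `j ≥ 0`, `0 ≤ ℓ < 2^j` and `k = (k₁, k₂) ∈ ℤ²`. -/
def curveletSystem (ν w : ℝ → ℝ) (χ₀ : EuclideanSpace ℝ (Fin 2) → ℝ) (α₁ α₂ : ℝ) :
    (Σ j : ℕ, Fin (2 ^ j) × ℤ × ℤ) → EuclideanSpace ℝ (Fin 2) → ℂ :=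
  fun i x => curveletZero ν w χ₀ α₁ α₂ i.1 i.2.2.1 i.2.2.2
    (rotT (Real.pi * ((i.2.1 : ℕ) : ℝ) / 2 ^ i.1) x)

end SignRetrieval

end

/-! The coefficients with `j = 1`, `ℓ = 0` already decide the sign. All coefficients are real, so
equality of moduli says that at each lattice point either the coefficient of `f - h` or that of `f +
h` vanishes. On the Fourier side let `p` and `q` be the spectra of `f - h` and `f + h` multiplied by
the window `χ_{1,0}`. Both live in a disk of radius `r ≤ 32/3`, where `r` is the outer radius of the
window, and the products of their transforms vanish on the sampling lattice. Hence all lattice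
Fourier coefficients of the convolution `p * q` vanish, that is, its periodization over the dual
lattice is zero.

The convolution lives in the disk of radius `2r`. Near the extreme point `(2r, 0)` a dual translate
in the first direction leaves the disk, because the period is at least `4r`, and a vertical
translate leaves a sufficiently thin cap. No aliasing reaches that cap, so `p * q` vanishes there
(`exists_cap_eq_zero`).

A Titchmarsh-type argument then shows that `p` or `q` vanishes near the line `ξ 0 = r`
(`ae_eq_zero_of_edgeTransform_mul_le`). The product of their Fourier–Laplace transforms decays
exponentially in the upper half-plane. By Poisson–Jensen on large circles tangent to the real axis,
one factor must decay too (`exp_decay_of_mul_exp_decay`), and Liouville's theorem turns the decay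
into a gap in the support.

The window is nonzero at points of the first axis arbitrarily close to this edge. So the spectrum of
`f - h` or of `f + h` vanishes on a nonempty open set. Exponential decay makes spectra
real-analytic, so that function is zero (`ExpDecay.ae_eq_zero_of_window`). -/

/-! ### Poisson–Jensen inequality and exponential decay of products in the half-plane. -/

open Metric MeromorphicOn Filter in
/-- For `u` in the closed disk, the Poisson integral of `log ‖· - u‖` dominates `log ‖w - u‖`. -/
theorem log_norm_sub_le_circleAverage_herglotz {c w u : ℂ} {R : ℝ} (hw : w ∈ ball c R)
    (hu : u ∈ closedBall c R) (hwu : w ≠ u) :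
    Real.log ‖w - u‖ ≤
      Real.circleAverage ((Complex.re ∘ herglotzRieszKernel c w) * (fun z => Real.log ‖z - u‖))
        c R := by
  have hR : 0 < R := pos_of_mem_ball hw
  rcases (mem_closedBall.1 hu).lt_or_eq with hlt | heq
  swap
  · rw [circleAverage_re_herglotzRieszKernel_mul_log (mem_sphere.2 heq) hw]
  set v : ℂ := u - c with hv
  have hvR : ‖v‖ < R := by simpa [hv, ← dist_eq_norm] using hlt
  have hwR : ‖w - c‖ < R := by simpa [← dist_eq_norm] using hw
  -- Reflecting the zero `u` in the circle gives a zero-free function on the closed disk with the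
  -- modulus of `z - u` on the circle and at least that modulus inside, by `hid`. Its log-modulus is
  -- harmonic, so the Poisson formula is exact for it.
  set g : ℂ → ℂ := fun z => (R : ℂ) - conj v * (z - c) / R with hg
  have hRc : (R : ℂ) ≠ 0 := by exact_mod_cast hR.ne'
  have hgne : ∀ z ∈ closedBall c R, g z ≠ 0 := by
    intro z hz h0
    have hz' : ‖z - c‖ ≤ R := by simpa [← dist_eq_norm] using hz
    have h1 : (R : ℂ) = conj v * (z - c) / R := by simpa [hg, sub_eq_zero] using h0
    have h2 := congrArg norm h1
    simp only [norm_div, norm_mul, RCLike.norm_conj, Complex.norm_real, Real.norm_eq_abs,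
      abs_of_pos hR] at h2
    rw [eq_div_iff hR.ne'] at h2
    nlinarith [norm_nonneg v, norm_nonneg (z - c)]
  have hharm : InnerProductSpace.HarmonicOnNhd (fun z => Real.log ‖g z‖) (closedBall c R) := by
    intro z hz
    refine AnalyticAt.harmonicAt_log_norm ?_ (hgne z hz)
    simp only [hg]; fun_prop (disch := exact hRc)
  have hkey := hharm.circleAverage_re_herglotzRieszKernel_smul hw
  have hid : ∀ z, ‖g z‖ ^ 2 - ‖z - u‖ ^ 2
      = (R ^ 2 - ‖z - c‖ ^ 2) * (R ^ 2 - ‖v‖ ^ 2) / R ^ 2 := by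
    intro z
    have e : z - u = (z - c) - v := by rw [hv]; ring
    have e2 : g z = (R : ℂ) - ((R⁻¹ : ℝ) : ℂ) * (conj v * (z - c)) := by
      simp only [hg]; push_cast; field_simp
    rw [e, e2]
    generalize z - c = t at *
    simp only [← Complex.normSq_eq_norm_sq, Complex.normSq_apply, Complex.sub_re, Complex.sub_im,
      Complex.mul_re, Complex.mul_im, Complex.ofReal_re, Complex.ofReal_im, Complex.conj_re,
      Complex.conj_im]
    field_simp
    ring
  have hsph : Real.circleAverage
        ((Complex.re ∘ herglotzRieszKernel c w) * (fun z => Real.log ‖z - u‖)) c R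
      = Real.circleAverage
        ((Complex.re ∘ herglotzRieszKernel c w) • (fun z => Real.log ‖g z‖)) c R := by
    refine Real.circleAverage_congr_sphere fun z hz => ?_
    have hz' : ‖z - c‖ = R := by simpa [← dist_eq_norm, abs_of_pos hR] using hz
    have h1 := hid z
    rw [hz', sub_self, zero_mul, zero_div, sub_eq_zero] at h1
    have h2 : ‖g z‖ = ‖z - u‖ := by
      rwa [sq_eq_sq₀ (norm_nonneg _) (norm_nonneg _)] at h1
    simp [h2]
  rw [hsph, hkey]
  refine Real.log_le_log (norm_pos_iff.2 (sub_ne_zero.2 hwu)) ?_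
  have h1 := hid w
  have h2 : 0 ≤ (R ^ 2 - ‖w - c‖ ^ 2) * (R ^ 2 - ‖v‖ ^ 2) / R ^ 2 := by
    have : 0 ≤ R ^ 2 - ‖w - c‖ ^ 2 := by nlinarith [norm_nonneg (w - c)]
    have : 0 ≤ R ^ 2 - ‖v‖ ^ 2 := by nlinarith [norm_nonneg v]
    positivity
  exact (sq_le_sq₀ (norm_nonneg _) (norm_nonneg _)).1 (by linarith)

open Metric Filter in
theorem CircleIntegrable.re_herglotz_mul {c w : ℂ} {R : ℝ} {g : ℂ → ℝ}
    (hg : CircleIntegrable g c R) (hw : w ∈ ball c R) :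
    CircleIntegrable ((Complex.re ∘ herglotzRieszKernel c w) * g) c R :=
  hg.continuousOn_smul
    (Complex.continuous_re.comp_continuousOn (continuousOn_herglotzRieszKernel_sphere hw))

open Metric MeromorphicOn Filter in
/-- **Poisson–Jensen inequality**: the Poisson integral of `log ‖f‖` over a circle dominates
`log ‖f‖` inside. -/
theorem AnalyticOnNhd.log_norm_le_circleAverage_herglotz {c w : ℂ} {R : ℝ} {f : ℂ → ℂ}
    (hf : AnalyticOnNhd ℂ f (closedBall c R)) (hw : w ∈ ball c R) (hfw : f w ≠ 0) :
    Real.log ‖f w‖ ≤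
      Real.circleAverage ((Complex.re ∘ herglotzRieszKernel c w) * (fun z => Real.log ‖f z‖))
        c R := by
  have hR : 0 < R := pos_of_mem_ball hw
  have hwc : w ∈ closedBall c R := ball_subset_closedBall hw
  set CB := closedBall c R with hCB
  have hmer : MeromorphicOn f CB := hf.meromorphicOn
  have hordw : meromorphicOrderAt f w = 0 := by
    rw [(hf w hwc).meromorphicOrderAt_eq, (hf w hwc).analyticOrderAt_eq_zero.2 hfw]; rfl
  have hord : ∀ u : CB, meromorphicOrderAt f u ≠ ⊤ := by
    rw [← hmer.exists_meromorphicOrderAt_ne_top_iff_forall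
      ⟨⟨w, hwc⟩, (convex_closedBall c R).isPreconnected⟩]
    exact ⟨⟨w, hwc⟩, by simp [hordw]⟩
  have hfin := (divisor f CB).finiteSupport (isCompact_closedBall c R)
  -- With the zeros divided out, `log ‖g‖` is harmonic and satisfies the Poisson formula with
  -- equality. The inequality comes from the linear factors alone, whose multiplicities are
  -- nonnegative because `f` is analytic.
  obtain ⟨g, hg, hg0, hfg⟩ := hmer.extract_zeros_poles hord hfin
  have hlog := extract_zeros_poles_log hg0 hfg
  have hacc : AccPt w (𝓟 CB) := by
    apply accPt_iff_frequently_nhdsNE.mpr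
    apply compl_notMem
    apply mem_nhdsWithin.mpr
    exact ⟨ball c R, isOpen_ball, hw, by simpa using! fun _ ⟨h, _⟩ ↦ ball_subset_closedBall h⟩
  have hval := log_norm_meromorphicTrailingCoeffAt_extract_zeros_poles hfin hwc hacc
    (hmer w hwc) (hg w hwc) (hg0 ⟨w, hwc⟩) hfg
  rw [(hf w hwc).meromorphicTrailingCoeffAt_of_ne_zero hfw] at hval
  have hDw : divisor f CB w = 0 := by simp [divisor_apply hmer hwc, hordw]
  have hsupp : ∀ u ∈ hfin.toFinset, u ∈ CB ∧ w ≠ u := by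
    intro u hu
    have hu' : divisor f CB u ≠ 0 := by simpa using hu
    refine ⟨(divisor f CB).supportWithinDomain (by simpa using hu'), ?_⟩
    rintro rfl; exact hu' hDw
  have hsum : ∀ x : ℂ, ∑ᶠ u, (divisor f CB u : ℝ) * Real.log ‖x - u‖
      = ∑ u ∈ hfin.toFinset, (divisor f CB u : ℝ) * Real.log ‖x - u‖ := by
    intro x
    refine finsum_eq_sum_of_support_subset _ fun u hu => ?_
    simp only [Function.mem_support] at hu
    simp only [Set.Finite.coe_toFinset, Function.mem_support]
    intro h; exact hu (by simp [h])
  have hsumf : (∑ᶠ u, (fun x : ℂ => (divisor f CB u : ℝ) * Real.log ‖x - u‖))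
      = ∑ u ∈ hfin.toFinset, (fun x : ℂ => (divisor f CB u : ℝ) * Real.log ‖x - u‖) := by
    refine finsum_eq_sum_of_support_subset _ fun u hu => ?_
    simp only [Function.mem_support] at hu
    simp only [Set.Finite.coe_toFinset, Function.mem_support]
    intro h; exact hu (by ext; simp [h])
  have hgharm : InnerProductSpace.HarmonicOnNhd (fun z => Real.log ‖g z‖) (closedBall c R) :=
    fun z hz => (hg z hz).harmonicAt_log_norm (hg0 ⟨z, hz⟩)
  have hsphere : sphere c |R| ⊆ CB := by rw [abs_of_pos hR]; exact sphere_subset_closedBall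
  have hint1 : ∀ u : ℂ, CircleIntegrable (fun x : ℂ => (divisor f CB u : ℝ) * Real.log ‖x - u‖)
      c R := fun u =>
    ((analyticOnNhd_id.sub analyticOnNhd_const).meromorphicOn.circleIntegrable_log_norm).const_smul
  have hint2 : CircleIntegrable (fun z => Real.log ‖g z‖) c R :=
    (hg.mono hsphere).meromorphicOn.circleIntegrable_log_norm
  have havg : Real.circleAverage
        ((Complex.re ∘ herglotzRieszKernel c w) * (fun z => Real.log ‖f z‖)) c R
      = ∑ u ∈ hfin.toFinset, (divisor f CB u : ℝ) * Real.circleAverage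
          ((Complex.re ∘ herglotzRieszKernel c w) * (fun z => Real.log ‖z - u‖)) c R
        + Real.log ‖g w‖ := by
    rw [← hgharm.circleAverage_re_herglotzRieszKernel_smul hw]
    have h1 : Real.circleAverage
        ((Complex.re ∘ herglotzRieszKernel c w) * (fun z => Real.log ‖f z‖)) c R
      = Real.circleAverage
        ((∑ u ∈ hfin.toFinset, ((Complex.re ∘ herglotzRieszKernel c w) *
          (fun x : ℂ => (divisor f CB u : ℝ) * Real.log ‖x - u‖))) +
          (Complex.re ∘ herglotzRieszKernel c w) • (fun z => Real.log ‖g z‖)) c R := by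
      refine Real.circleAverage_congr_codiscreteWithin ?_ hR.ne'
      filter_upwards [codiscreteWithin_mono hsphere hlog] with z hz
      have hz' : Real.log ‖f z‖ = (∑ᶠ u, (fun x : ℂ => (divisor f CB u : ℝ) * Real.log ‖x - u‖)) z
        + Real.log ‖g z‖ := hz
      rw [hsumf] at hz'
      simp only [Pi.mul_apply, Pi.add_apply, Finset.sum_apply, smul_eq_mul, hz',
        mul_add, Finset.mul_sum]
    rw [h1, Real.circleAverage_add, Real.circleAverage_sum]
    · congr 1
      refine Finset.sum_congr rfl fun u _ => ?_
      rw [← smul_eq_mul (divisor f CB u : ℝ), ← Real.circleAverage_fun_smul]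
      congr 1; ext z
      simp only [Pi.mul_apply, smul_eq_mul]; ring
    · exact fun u _ => (hint1 u).re_herglotz_mul hw
    · exact CircleIntegrable.sum _ fun u _ => (hint1 u).re_herglotz_mul hw
    · exact hint2.re_herglotz_mul hw
  rw [havg, hval, hsum]
  gcongr with u hu
  · exact_mod_cast hf.divisor_nonneg u
  · exact log_norm_sub_le_circleAverage_herglotz hw (hsupp u hu).1 (hsupp u hu).2

open Metric in
/-- Harnack form of the Poisson–Jensen inequality for a function bounded by one. -/
theorem AnalyticOnNhd.log_norm_le_mul_circleAverage {c w : ℂ} {R : ℝ} {f : ℂ → ℂ}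
    (hf : AnalyticOnNhd ℂ f (closedBall c R)) (hw : w ∈ ball c R) (hfw : f w ≠ 0)
    (hf1 : ∀ z ∈ sphere c R, ‖f z‖ ≤ 1) :
    Real.log ‖f w‖ ≤ (R - ‖w - c‖) / (R + ‖w - c‖) *
      Real.circleAverage (fun z => Real.log ‖f z‖) c R := by
  have hR : 0 < R := pos_of_mem_ball hw
  have hsphere : sphere c |R| ⊆ closedBall c R := by
    rw [abs_of_pos hR]; exact sphere_subset_closedBall
  have hint : CircleIntegrable (fun z => Real.log ‖f z‖) c R :=
    (hf.mono hsphere).meromorphicOn.circleIntegrable_log_norm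
  refine (hf.log_norm_le_circleAverage_herglotz hw hfw).trans ?_
  rw [← smul_eq_mul ((R - ‖w - c‖) / (R + ‖w - c‖)), ← Real.circleAverage_fun_smul]
  refine Real.circleAverage_mono (hint.re_herglotz_mul hw) hint.const_smul fun z hz => ?_
  rw [abs_of_pos hR] at hz
  -- The lower bound for the kernel becomes an upper bound after multiplication by `log ‖f z‖ ≤ 0`.
  have h1 := le_re_herglotzRieszKernel hz hw
  have h2 : Real.log ‖f z‖ ≤ 0 := Real.log_nonpos (norm_nonneg _) (hf1 z hz)
  simpa [herglotzRieszKernel_def] using mul_le_mul_of_nonpos_right h1 h2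

-- The circle with centre `iR` and radius `R` touches the real axis at `0` and stays in the closed
-- upper half-plane, so the product bound holds on it. The affine function `N - δ Im z` averages to
-- its value at the centre.
open Metric Filter in
theorem circleAverage_log_norm_add_le {P Q : ℂ → ℂ} (hP : Differentiable ℂ P)
    (hQ : Differentiable ℂ Q) (hP0 : ∃ z, P z ≠ 0) (hQ0 : ∃ z, Q z ≠ 0) {δ N R : ℝ} (hR : 0 < R)
    (hPQ : ∀ z : ℂ, 0 ≤ z.im → ‖P z * Q z‖ ≤ Real.exp (N - δ * z.im)) :
    Real.circleAverage (fun z => Real.log ‖P z‖) (R * Complex.I) R +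
      Real.circleAverage (fun z => Real.log ‖Q z‖) (R * Complex.I) R ≤ N - δ * R := by
  have hint : ∀ {f : ℂ → ℂ}, Differentiable ℂ f →
      CircleIntegrable (fun z => Real.log ‖f z‖) (R * Complex.I) R := fun hf =>
    MeromorphicOn.circleIntegrable_log_norm fun z _ =>
      (hf.analyticAt z).meromorphicAt
  have hcod : ∀ {f : ℂ → ℂ}, Differentiable ℂ f → (∃ z, f z ≠ 0) →
      ∀ᶠ z in codiscreteWithin (sphere (R * Complex.I) |R|), f z ≠ 0 := by
    rintro f hf ⟨x, hx⟩
    have h := AnalyticOnNhd.preimage_zero_mem_codiscrete (x := x)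
      (fun z _ => hf.analyticAt z) hx
    exact codiscreteWithin_mono (Set.subset_univ _) h
  have hlin : Real.circleAverage (fun z : ℂ => N - δ * z.im) (R * Complex.I) R = N - δ * R := by
    have hd : DiffContOnCl ℂ (fun z : ℂ => (N : ℂ) + δ * (Complex.I * z))
        (ball (R * Complex.I) |R|) := Differentiable.diffContOnCl (by fun_prop)
    have h1 := hd.circleAverage
    have h2 := Complex.reCLM.circleAverage_comp_comm
      (f := fun z : ℂ => (N : ℂ) + δ * (Complex.I * z)) (c := R * Complex.I) (R := R)
      (ContinuousOn.circleIntegrable' (by fun_prop))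
    rw [h1] at h2
    simpa [Function.comp_def, sub_eq_add_neg] using h2
  rw [← Real.circleAverage_fun_add (hint hP) (hint hQ), ← hlin]
  classical
  -- In Lean `log 0 = 0`, so the pointwise bound may fail at zeros of `P` or `Q`. These are
  -- negligible for the average, and `F` redefines the integrand there.
  let F : ℂ → ℝ := fun z => if P z = 0 ∨ Q z = 0 then N - δ * z.im
    else Real.log ‖P z‖ + Real.log ‖Q z‖
  have hF : (fun z => Real.log ‖P z‖ + Real.log ‖Q z‖)
      =ᶠ[codiscreteWithin (sphere (R * Complex.I) |R|)] F := by
    filter_upwards [hcod hP hP0, hcod hQ hQ0] with z h1 h2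
    simp [F, h1, h2]
  rw [Real.circleAverage_congr_codiscreteWithin hF hR.ne']
  refine Real.circleAverage_mono (((hint hP).add (hint hQ)).congr_codiscreteWithin hF)
    (ContinuousOn.circleIntegrable' (by fun_prop)) fun z hz => ?_
  have hz0 : 0 ≤ z.im := by
    have h1 : |(z - R * Complex.I).im| ≤ R := by
      refine (Complex.abs_im_le_norm _).trans (le_of_eq ?_)
      simpa [← dist_eq_norm, abs_of_pos hR] using hz
    have := (abs_le.1 h1).1
    simp at this
    linarith
  simp only [F]
  split_ifs with h
  · exact le_rfl
  · push Not at h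
    rw [← Real.log_mul (norm_ne_zero_iff.2 h.1) (norm_ne_zero_iff.2 h.2), ← norm_mul]
    rw [Real.log_le_iff_le_exp (norm_pos_iff.2 (mul_ne_zero h.1 h.2))]
    exact hPQ z hz0

-- With `d = ‖z - iR‖`, the Harnack factor `(R - d) / (R + d)` is asymptotic to `Im z / (2R)`.
-- Against the average bound, of order `-δR/2`, it leaves `-(δ/4) Im z` in the limit; arbitrarily
-- large `R` suffice.
open Metric Filter in
theorem norm_le_exp_of_frequently_circleAverage_le {P : ℂ → ℂ} (hP : Differentiable ℂ P)
    (hP1 : ∀ z : ℂ, 0 ≤ z.im → ‖P z‖ ≤ 1) {δ N : ℝ} (hδ : 0 < δ)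
    (hfreq : ∃ᶠ R : ℝ in atTop,
      Real.circleAverage (fun z => Real.log ‖P z‖) (R * Complex.I) R ≤ (N - δ * R) / 2)
    (z : ℂ) (hz : 0 < z.im) : ‖P z‖ ≤ Real.exp (-(δ / 4) * z.im) := by
  rcases eq_or_ne (P z) 0 with h0 | h0
  · rw [h0, norm_zero]; positivity
  rw [← Real.log_le_iff_le_exp (norm_pos_iff.2 h0)]
  have hlim : Tendsto (fun R : ℝ => (2 * z.im - ‖z‖ ^ 2 / R) * (N / R - δ) / 8) atTop
      (nhds ((2 * z.im - 0) * (0 - δ) / 8)) :=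
    (((tendsto_const_nhds.sub (tendsto_const_nhds.div_atTop tendsto_id)).mul
      ((tendsto_const_nhds.div_atTop tendsto_id).sub tendsto_const_nhds)).div_const _)
  have e : (2 * z.im - 0) * (0 - δ) / 8 = -(δ / 4) * z.im := by ring
  rw [e] at hlim
  refine ge_of_tendsto_of_frequently hlim ?_
  have hev : ∀ᶠ R : ℝ in atTop, 0 < R ∧ ‖z‖ ^ 2 / (2 * z.im) < R ∧ N / δ < R :=
    (eventually_gt_atTop _).and ((eventually_gt_atTop _).and (eventually_gt_atTop _))
  refine (hfreq.and_eventually hev).mono ?_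
  rintro R ⟨hRavg, hR, hR1, hR2⟩
  rw [div_lt_iff₀ (by positivity)] at hR1
  rw [div_lt_iff₀ hδ] at hR2
  set d := ‖z - R * Complex.I‖ with hd
  have hd2 : d ^ 2 = R ^ 2 - (2 * R * z.im - ‖z‖ ^ 2) := by
    rw [hd, ← Complex.normSq_eq_norm_sq, ← Complex.normSq_eq_norm_sq]
    simp [Complex.normSq_apply]; ring
  have hd0 : 0 ≤ d := norm_nonneg _
  have hdR : d < R := by
    refine lt_of_pow_lt_pow_left₀ 2 hR.le ?_
    rw [hd2]; linarith
  have hsub : ∀ w ∈ closedBall (R * Complex.I) R, 0 ≤ w.im := by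
    intro w hw
    have h1 : |(w - R * Complex.I).im| ≤ R := by
      refine (Complex.abs_im_le_norm _).trans ?_
      simpa [← dist_eq_norm] using hw
    have := (abs_le.1 h1).1
    simp at this
    linarith
  have key := AnalyticOnNhd.log_norm_le_mul_circleAverage (c := R * Complex.I) (w := z) (R := R)
    (fun w _ => hP.analyticAt w) (by simpa [dist_eq_norm] using hdR) h0
    (fun w hw => hP1 w (hsub w (sphere_subset_closedBall hw)))
  rw [← hd] at key
  have hneg : (N - δ * R) / 2 < 0 := by nlinarith
  have hk : (2 * R * z.im - ‖z‖ ^ 2) / (4 * R ^ 2) ≤ (R - d) / (R + d) := by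
    rw [div_le_div_iff₀ (by positivity) (by positivity)]
    have : 2 * R * z.im - ‖z‖ ^ 2 = (R - d) * (R + d) := by nlinarith
    rw [this]
    have h4 : (R + d) ^ 2 ≤ 4 * R ^ 2 := by nlinarith
    nlinarith [mul_le_mul_of_nonneg_left h4 (sub_nonneg.2 hdR.le)]
  calc Real.log ‖P z‖ ≤ (R - d) / (R + d) * ((N - δ * R) / 2) :=
        key.trans (mul_le_mul_of_nonneg_left hRavg (by
          have := sub_nonneg.2 hdR.le; positivity))
    _ ≤ (2 * R * z.im - ‖z‖ ^ 2) / (4 * R ^ 2) * ((N - δ * R) / 2) :=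
        mul_le_mul_of_nonpos_right hk hneg.le
    _ = (2 * z.im - ‖z‖ ^ 2 / R) * (N / R - δ) / 8 := by
        field_simp
        ring

open Filter in
/-- Two functions bounded by one on the upper half-plane whose product decays exponentially in the
vertical direction: one of them decays exponentially. -/
theorem exp_decay_of_mul_exp_decay {P Q : ℂ → ℂ} (hP : Differentiable ℂ P)
    (hQ : Differentiable ℂ Q) (hP1 : ∀ z : ℂ, 0 ≤ z.im → ‖P z‖ ≤ 1)
    (hQ1 : ∀ z : ℂ, 0 ≤ z.im → ‖Q z‖ ≤ 1) {δ N : ℝ} (hδ : 0 < δ)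
    (hPQ : ∀ z : ℂ, 0 ≤ z.im → ‖P z * Q z‖ ≤ Real.exp (N - δ * z.im)) :
    (∀ z : ℂ, 0 < z.im → ‖P z‖ ≤ Real.exp (-(δ / 4) * z.im)) ∨
      ∀ z : ℂ, 0 < z.im → ‖Q z‖ ≤ Real.exp (-(δ / 4) * z.im) := by
  by_cases hP0 : ∃ z, P z ≠ 0
  swap
  · push Not at hP0
    left; intro z _; rw [hP0, norm_zero]; positivity
  by_cases hQ0 : ∃ z, Q z ≠ 0
  swap
  · push Not at hQ0
    right; intro z _; rw [hQ0, norm_zero]; positivity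
  -- For each `R > 0` one of two averages is at most half the bound for their sum; the same factor
  -- must be chosen for arbitrarily large `R`.
  have hfreq : ∃ᶠ R : ℝ in atTop,
      (Real.circleAverage (fun z => Real.log ‖P z‖) (R * Complex.I) R ≤ (N - δ * R) / 2 ∨
      Real.circleAverage (fun z => Real.log ‖Q z‖) (R * Complex.I) R ≤ (N - δ * R) / 2) := by
    refine Eventually.frequently ((eventually_gt_atTop 0).mono fun R hR => ?_)
    have h := circleAverage_log_norm_add_le hP hQ hP0 hQ0 hR hPQ
    by_contra! hcon
    linarith [hcon.1, hcon.2]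
  rcases frequently_or_distrib.1 hfreq with h | h
  · exact Or.inl (norm_le_exp_of_frequently_circleAverage_le hP hP1 hδ h)
  · exact Or.inr (norm_le_exp_of_frequently_circleAverage_le hQ hQ1 hδ h)

/-! ### Fourier uniqueness and holomorphic exponential integrals. -/

open SchwartzMap in
/-- Injectivity of the Fourier transform on integrable functions. -/
theorem ae_eq_zero_of_fourier_eq_zero {V : Type*} [NormedAddCommGroup V] [InnerProductSpace ℝ V]
    [FiniteDimensional ℝ V] [MeasurableSpace V] [BorelSpace V] {g : V → ℂ}
    (hg : Integrable g) (h : ∀ ξ, 𝓕 g ξ = 0) : ∀ᵐ x, g x = 0 := by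
  refine ae_eq_zero_of_integral_contDiff_smul_eq_zero hg.locallyIntegrable fun φ hφ hφc => ?_
  have h1 : HasCompactSupport (fun x => (φ x : ℂ)) := hφc.comp_left Complex.ofReal_zero
  have h2 : ContDiff ℝ ∞ (fun x => (φ x : ℂ)) := Complex.ofRealCLM.contDiff.comp hφ
  set Φ : 𝓢(V, ℂ) := h1.toSchwartzMap h2 with hΦ
  -- Each test function is itself the Fourier transform of a Schwartz function, so the
  -- multiplication formula moves the transform onto `g`.
  set Ψ : 𝓢(V, ℂ) := 𝓕⁻ Φ with hΨ
  have h3 : 𝓕 (Ψ : V → ℂ) = Φ := by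
    rw [← SchwartzMap.fourier_coe, hΨ, FourierTransform.fourier_fourierInv_eq]
  have key := VectorFourier.integral_fourierIntegral_smul_eq_flip (L := innerₗ V)
    (μ := volume) (ν := volume) Real.continuous_fourierChar continuous_inner hg Ψ.integrable
  have h4 : ∀ ξ, VectorFourier.fourierIntegral Real.fourierChar volume (innerₗ V) g ξ = 0 := h
  have h5 : ∀ x, VectorFourier.fourierIntegral Real.fourierChar volume (innerₗ V).flip Ψ x
      = φ x := by
    intro x
    rw [flip_innerₗ]
    exact congrFun h3 x
  simp only [h4, h5, zero_smul, integral_zero] at key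
  rw [key]
  refine integral_congr_ae (Filter.Eventually.of_forall fun x => ?_)
  simp [mul_comm]

open Metric in
/-- Exponential integrals depend holomorphically on the parameter. -/
theorem differentiableOn_integral_mul_cexp {X : Type*} [MeasurableSpace X] {μ : Measure X}
    {g : X → ℂ} {L : X → ℝ} (hg : AEStronglyMeasurable g μ) (hL : AEMeasurable L μ) {c : ℝ}
    (h : Integrable (fun x => ‖g x‖ * Real.exp (c * |L x|)) μ) :
    DifferentiableOn ℂ (fun z : ℂ => ∫ x, g x * Complex.exp (z * L x) ∂μ) {z | |z.re| < c} := by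
  intro z₀ hz₀
  have hz₀' : |z₀.re| < c := hz₀
  -- Half of the margin keeps `z` inside the strip; the other half absorbs the factor `|L x|`
  -- produced by differentiation.
  set ε : ℝ := (c - |z₀.re|) / 2 with hε
  have hε0 : 0 < ε := by rw [hε]; linarith
  have hmeas : ∀ z : ℂ, AEStronglyMeasurable (fun x => g x * Complex.exp (z * L x)) μ := by
    intro z
    refine hg.mul (AEMeasurable.aestronglyMeasurable ?_)
    fun_prop
  have hre : ∀ z ∈ ball z₀ ε, ∀ x, z.re * L x ≤ (c - ε) * |L x| := by
    intro z hz x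
    have h1 : |z.re - z₀.re| < ε := by
      refine lt_of_le_of_lt ?_ (mem_ball_iff_norm.1 hz)
      simpa using Complex.abs_re_le_norm (z - z₀)
    have h2 : |z.re| ≤ c - ε := by
      have := abs_sub_abs_le_abs_sub z.re z₀.re
      rw [hε] at *; linarith
    calc z.re * L x ≤ |z.re * L x| := le_abs_self _
      _ = |z.re| * |L x| := abs_mul _ _
      _ ≤ _ := by gcongr
  have hbound : ∀ z ∈ ball z₀ ε, ∀ x,
      ‖Complex.exp (z * L x)‖ ≤ Real.exp ((c - ε) * |L x|) := by
    intro z hz x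
    rw [Complex.norm_exp]
    simpa using hre z hz x
  have hF' : ∀ᵐ x ∂μ, ∀ z ∈ ball z₀ ε,
      ‖g x * (Complex.exp (z * L x) * L x)‖ ≤ ε⁻¹ * (‖g x‖ * Real.exp (c * |L x|)) := by
    refine Filter.Eventually.of_forall fun x z hz => ?_
    rw [norm_mul, norm_mul, Complex.norm_real, Real.norm_eq_abs]
    have h1 : ε * |L x| ≤ Real.exp (ε * |L x|) := by
      have := Real.add_one_le_exp (ε * |L x|); linarith
    have h2 : |L x| ≤ ε⁻¹ * Real.exp (ε * |L x|) := by
      rw [inv_mul_eq_div, le_div_iff₀ hε0]; linarith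
    calc ‖g x‖ * (‖Complex.exp (z * L x)‖ * |L x|)
        ≤ ‖g x‖ * (Real.exp ((c - ε) * |L x|) * (ε⁻¹ * Real.exp (ε * |L x|))) := by
          gcongr; exact hbound z hz x
      _ = ε⁻¹ * (‖g x‖ * Real.exp (c * |L x|)) := by
          have : Real.exp (c * |L x|) = Real.exp ((c - ε) * |L x|) * Real.exp (ε * |L x|) := by
            rw [← Real.exp_add]; ring_nf
          rw [this]; ring
  have hint : Integrable (fun x => g x * Complex.exp (z₀ * L x)) μ := by
    refine h.mono' (hmeas z₀) (Filter.Eventually.of_forall fun x => ?_)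
    rw [norm_mul]
    gcongr
    refine (hbound z₀ (mem_ball_self hε0) x).trans ?_
    gcongr
    linarith
  have := (hasDerivAt_integral_of_dominated_loc_of_deriv_le (ball_mem_nhds z₀ hε0)
    (F := fun (z : ℂ) x => g x * Complex.exp (z * L x))
    (F' := fun (z : ℂ) x => g x * (Complex.exp (z * L x) * L x))
    (Filter.Eventually.of_forall hmeas) hint
    (hg.mul (AEMeasurable.aestronglyMeasurable (by fun_prop))) hF' (h.const_mul _)
    (Filter.Eventually.of_forall fun x z _ => by
      have h1 : HasDerivAt (fun z : ℂ => z * (L x : ℂ)) (L x : ℂ) z := by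
        simpa using (hasDerivAt_id z).mul_const (L x : ℂ)
      exact (h1.cexp).const_mul (g x))).2
  exact this.differentiableAt.differentiableWithinAt

/-- Exponential integrals over a set where the exponent is bounded are entire in the parameter. -/
theorem differentiable_integral_mul_cexp {X : Type*} [MeasurableSpace X] {μ : Measure X}
    {g : X → ℂ} {L : X → ℝ} (hg : Integrable g μ) (hL : AEMeasurable L μ) {B : ℝ}
    (hB : ∀ x, g x ≠ 0 → |L x| ≤ B) :
    Differentiable ℂ (fun z : ℂ => ∫ x, g x * Complex.exp (z * L x) ∂μ) := by
  intro z
  have hc : |z.re| < |z.re| + 1 := lt_add_one _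
  have h : Integrable (fun x => ‖g x‖ * Real.exp ((|z.re| + 1) * |L x|)) μ := by
    refine (hg.norm.mul_const (Real.exp ((|z.re| + 1) * B))).mono'
      (hg.norm.aestronglyMeasurable.mul (AEMeasurable.aestronglyMeasurable (by fun_prop)))
      (Filter.Eventually.of_forall fun x => ?_)
    rw [Real.norm_eq_abs, abs_of_nonneg (by positivity)]
    rcases eq_or_ne (g x) 0 with h0 | h0
    · simp [h0]
    · gcongr; exact hB x h0
  refine (differentiableOn_integral_mul_cexp hg.aestronglyMeasurable hL h).differentiableAt ?_
  exact (isOpen_lt (by fun_prop) continuous_const).mem_nhds hc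

/-! ### Edge transforms and a two-dimensional Titchmarsh theorem. -/

namespace SignRetrieval

/-- The partial Fourier–Laplace transform of `p`, in the first frequency measured from the
line `ξ 0 = r`. -/
noncomputable def edgeTransform (p : EuclideanSpace ℝ (Fin 2) → ℂ) (r s : ℝ) (z : ℂ) : ℂ :=
  ∫ ξ, p ξ * Complex.exp (2 * Real.pi * s * ξ 1 * Complex.I) *
    Complex.exp (2 * Real.pi * Complex.I * z * ((r - ξ 0 : ℝ) : ℂ))

variable {p q : EuclideanSpace ℝ (Fin 2) → ℂ} {ρ r s η : ℝ}

theorem integrable_mul_cexp_I (hp : Integrable p) (s : ℝ) (i : Fin 2) :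
    Integrable (fun ξ => p ξ * Complex.exp (2 * Real.pi * s * ξ i * Complex.I)) := by
  refine hp.mul_bdd (c := 1) (Continuous.aestronglyMeasurable (by fun_prop))
    (Filter.Eventually.of_forall fun ξ => ?_)
  rw [Complex.norm_exp]; simp

theorem abs_sub_coord_le (hpρ : ∀ ξ, p ξ ≠ 0 → ‖ξ‖ ≤ ρ) (r : ℝ) (i : Fin 2)
    (ξ : EuclideanSpace ℝ (Fin 2)) (h : p ξ ≠ 0) : |r - ξ i| ≤ |r| + ρ := by
  have h1 : ‖ξ i‖ ≤ ‖ξ‖ := PiLp.norm_apply_le ξ i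
  rw [Real.norm_eq_abs] at h1
  exact (abs_sub _ _).trans (by linarith [hpρ ξ h])

theorem differentiable_edgeTransform (hp : Integrable p) (hpρ : ∀ ξ, p ξ ≠ 0 → ‖ξ‖ ≤ ρ)
    (r s : ℝ) : Differentiable ℂ (edgeTransform p r s) := by
  have h := differentiable_integral_mul_cexp (integrable_mul_cexp_I hp s 1)
    (L := fun ξ => r - ξ 0) (Measurable.aemeasurable (by fun_prop)) (B := |r| + ρ)
    (fun ξ h0 => abs_sub_coord_le hpρ r 0 ξ (left_ne_zero_of_mul h0))
  exact h.comp (g := fun z : ℂ => ∫ ξ : EuclideanSpace ℝ (Fin 2),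
    p ξ * Complex.exp (2 * Real.pi * s * ξ 1 * Complex.I) *
      Complex.exp (z * ((r - ξ 0 : ℝ) : ℂ))) (f := fun z => 2 * Real.pi * Complex.I * z)
    (by fun_prop)

/-- The last exponential has modulus `exp (-2π z.im (r - ξ 0))`. The hypothesis covers both the
upper half-plane with mass on the left of the edge and the lower half-plane with mass on the right.
-/
theorem norm_edgeTransform_le (hp : Integrable p) {z : ℂ}
    (h : ∀ ξ, p ξ ≠ 0 → 0 ≤ z.im * (r - ξ 0)) : ‖edgeTransform p r s z‖ ≤ ∫ ξ, ‖p ξ‖ := by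
  refine (norm_integral_le_integral_norm _).trans ?_
  refine integral_mono_of_nonneg (Filter.Eventually.of_forall fun ξ => norm_nonneg _) hp.norm
    (Filter.Eventually.of_forall fun ξ => ?_)
  rcases eq_or_ne (p ξ) 0 with h0 | h0
  · simp [h0]
  have h1 := h ξ h0
  simp only [norm_mul, Complex.norm_exp]
  have e1 : (2 * Real.pi * s * ξ 1 * Complex.I : ℂ).re = 0 := by simp
  have e2 : (2 * Real.pi * Complex.I * z * ((r - ξ 0 : ℝ) : ℂ)).re
      = -(2 * Real.pi * (z.im * (r - ξ 0))) := by
    simp; ring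
  rw [e1, e2, Real.exp_zero, mul_one]
  refine mul_le_of_le_one_right (norm_nonneg _) (Real.exp_le_one_iff.2 ?_)
  have := Real.pi_pos
  have : 0 ≤ 2 * Real.pi * (z.im * (r - ξ 0)) := by positivity
  linarith

theorem edgeTransform_sub_shift (p : EuclideanSpace ℝ (Fin 2) → ℂ) (r s η : ℝ) (z : ℂ) :
    edgeTransform p (r - η) s z =
      edgeTransform p r s z * Complex.exp (-(2 * Real.pi * Complex.I * z * η)) := by
  unfold edgeTransform
  rw [← integral_mul_const]
  congr 1; ext ξ
  simp only [mul_assoc, ← Complex.exp_add]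
  congr 2; push_cast; ring

theorem integrable_edge_integrand (hp : Integrable p) (hpρ : ∀ ξ, p ξ ≠ 0 → ‖ξ‖ ≤ ρ)
    (r s : ℝ) (z : ℂ) :
    Integrable (fun ξ => p ξ * Complex.exp (2 * Real.pi * s * ξ 1 * Complex.I) *
      Complex.exp (2 * Real.pi * Complex.I * z * ((r - ξ 0 : ℝ) : ℂ))) := by
  refine ((integrable_mul_cexp_I hp s 1).norm.mul_const
    (Real.exp (2 * Real.pi * ‖z‖ * (|r| + ρ)))).mono'
    ((integrable_mul_cexp_I hp s 1).aestronglyMeasurable.mul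
      (Continuous.aestronglyMeasurable (by fun_prop))) (Filter.Eventually.of_forall fun ξ => ?_)
  rw [norm_mul]
  rcases eq_or_ne (p ξ) 0 with h0 | h0
  · simp [h0]
  gcongr
  refine (Complex.norm_exp_le_exp_norm _).trans ?_
  gcongr
  rw [norm_mul, norm_mul, norm_mul, Complex.norm_real (r - ξ 0), Real.norm_eq_abs]
  simp only [Complex.norm_mul, Complex.norm_ofNat, Complex.norm_real, Real.norm_eq_abs,
    abs_of_pos Real.pi_pos, Complex.norm_I, mul_one]
  have := Real.pi_pos
  gcongr
  exact abs_sub_coord_le hpρ r 0 ξ h0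

open Filter Topology in
/-- If the edge transform decays like `e^{-2πη Im z}`, then the part of `p` in
`r - η < ξ 0` has vanishing edge transform. -/
theorem edgeTransform_indicator_eq_zero (hp : Integrable p) (hpρ : ∀ ξ, p ξ ≠ 0 → ‖ξ‖ ≤ ρ)
    {M : ℝ} (h : ∀ z : ℂ, 0 < z.im →
      ‖edgeTransform p r s z‖ ≤ M * Real.exp (-(2 * Real.pi * η) * z.im)) (z : ℂ) :
    edgeTransform ({ξ : EuclideanSpace ℝ (Fin 2) | r - η < ξ 0}.indicator p) (r - η) s z = 0 := by
  set S : Set (EuclideanSpace ℝ (Fin 2)) := {ξ | r - η < ξ 0} with hS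
  have hSm : MeasurableSet S := measurableSet_lt measurable_const (by fun_prop)
  set p₁ := S.indicator p with hp₁
  set p₂ := Sᶜ.indicator p with hp₂
  have hp₁i : Integrable p₁ := hp.indicator hSm
  have hp₂i : Integrable p₂ := hp.indicator hSm.compl
  have hne₁ : ∀ ξ, p₁ ξ ≠ 0 → p ξ ≠ 0 ∧ r - η < ξ 0 := fun ξ hξ => by
    have h1 := Set.mem_of_indicator_ne_zero hξ
    exact ⟨by simpa [hp₁, h1] using hξ, h1⟩
  have hne₂ : ∀ ξ, p₂ ξ ≠ 0 → p ξ ≠ 0 ∧ ξ 0 ≤ r - η := fun ξ hξ => by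
    have h1 : ξ ∈ Sᶜ := Set.mem_of_indicator_ne_zero hξ
    refine ⟨by simpa [hp₂, h1] using hξ, by simpa [hS] using h1⟩
  have hadd : ∀ z, edgeTransform p (r - η) s z
      = edgeTransform p₁ (r - η) s z + edgeTransform p₂ (r - η) s z := by
    intro z
    unfold edgeTransform
    rw [← integral_add
      (integrable_edge_integrand hp₁i (fun ξ hξ => hpρ ξ (hne₁ ξ hξ).1) _ _ _)
      (integrable_edge_integrand hp₂i (fun ξ hξ => hpρ ξ (hne₂ ξ hξ).1) _ _ _)]
    congr 1; ext ξ
    rw [← add_mul, ← add_mul]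
    congr 2
    exact (congrFun (Set.indicator_self_add_compl S p) ξ).symm
  have hM : ∀ z : ℂ, 0 < z.im → ‖edgeTransform p (r - η) s z‖ ≤ M := by
    intro z hz
    rw [edgeTransform_sub_shift, norm_mul, Complex.norm_exp]
    have e : (-(2 * Real.pi * Complex.I * z * η)).re = (2 * Real.pi * η) * z.im := by
      simp; ring
    rw [e]
    calc _ ≤ M * Real.exp (-(2 * Real.pi * η) * z.im) * Real.exp (2 * Real.pi * η * z.im) := by
          gcongr; exact h z hz
      _ = M := by rw [mul_assoc, ← Real.exp_add]; simp
  -- In the upper half-plane `p₁ = p - p₂` is a difference of two bounded transforms; in the lower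
  -- one `p₁` is bounded by itself, since its mass lies right of `r - η`. Liouville makes the
  -- transform constant, and its limit along `-in` shows that the constant is zero.
  have hbdd : Bornology.IsBounded (Set.range (edgeTransform p₁ (r - η) s)) := by
    refine isBounded_iff_forall_norm_le.2
      ⟨max (M + ∫ ξ, ‖p₂ ξ‖) (∫ ξ, ‖p₁ ξ‖), ?_⟩
    rintro _ ⟨z, rfl⟩
    rcases lt_or_ge 0 z.im with hz | hz
    · refine le_max_of_le_left ?_
      have e : edgeTransform p₁ (r - η) s z
          = edgeTransform p (r - η) s z - edgeTransform p₂ (r - η) s z := by rw [hadd]; ring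
      rw [e]
      refine (norm_sub_le _ _).trans (add_le_add (hM z hz) (norm_edgeTransform_le hp₂i ?_))
      intro ξ hξ
      exact mul_nonneg hz.le (by linarith [(hne₂ ξ hξ).2])
    · refine le_max_of_le_right (norm_edgeTransform_le hp₁i ?_)
      intro ξ hξ
      exact mul_nonneg_of_nonpos_of_nonpos hz (by linarith [(hne₁ ξ hξ).2])
  have hconst := (differentiable_edgeTransform hp₁i (fun ξ hξ => hpρ ξ (hne₁ ξ hξ).1)
    (r - η) s).apply_eq_apply_of_bounded hbdd z
  have hlim : Tendsto (fun n : ℕ => edgeTransform p₁ (r - η) s (-(n * Complex.I))) atTop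
      (𝓝 (∫ _ : EuclideanSpace ℝ (Fin 2), (0 : ℂ))) := by
    unfold edgeTransform
    refine tendsto_integral_of_dominated_convergence (fun ξ => ‖p₁ ξ‖) ?_ hp₁i.norm ?_ ?_
    · intro n
      exact (integrable_edge_integrand hp₁i
        (fun ξ hξ => hpρ ξ (hne₁ ξ hξ).1) _ _ _).aestronglyMeasurable
    all_goals
      have hn : ∀ (n : ℕ) (ξ : EuclideanSpace ℝ (Fin 2)),
        ‖p₁ ξ * Complex.exp (2 * Real.pi * s * ξ 1 * Complex.I) *
          Complex.exp (2 * Real.pi * Complex.I * (-(n * Complex.I)) * ((r - η - ξ 0 : ℝ) : ℂ))‖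
          = ‖p₁ ξ‖ * Real.exp (2 * Real.pi * (r - η - ξ 0)) ^ n := by
        intro n ξ
        rw [norm_mul, norm_mul, Complex.norm_exp, Complex.norm_exp, ← Real.exp_nat_mul]
        have e1 : (2 * Real.pi * s * ξ 1 * Complex.I : ℂ).re = 0 := by simp
        rw [e1, Real.exp_zero, mul_one]
        congr 2
        simp; ring
    · refine fun n => Filter.Eventually.of_forall fun ξ => ?_
      rw [hn]
      rcases eq_or_ne (p₁ ξ) 0 with h0 | h0
      · simp [h0]
      refine mul_le_of_le_one_right (norm_nonneg _) (pow_le_one₀ (Real.exp_pos _).le ?_)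
      rw [Real.exp_le_one_iff]
      nlinarith [(hne₁ ξ h0).2, Real.pi_pos]
    · refine Filter.Eventually.of_forall fun ξ => ?_
      rw [tendsto_zero_iff_norm_tendsto_zero]
      simp only [hn]
      rcases eq_or_ne (p₁ ξ) 0 with h0 | h0
      · simp [h0]
      rw [← mul_zero ‖p₁ ξ‖]
      refine (tendsto_pow_atTop_nhds_zero_of_lt_one (Real.exp_pos _).le ?_).const_mul _
      rw [Real.exp_lt_one_iff]
      nlinarith [(hne₁ ξ h0).2, Real.pi_pos]
  have hc : ∀ n : ℕ, edgeTransform p₁ (r - η) s (-(n * Complex.I))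
      = edgeTransform p₁ (r - η) s z := fun n =>
    (differentiable_edgeTransform hp₁i (fun ξ hξ => hpρ ξ (hne₁ ξ hξ).1)
      (r - η) s).apply_eq_apply_of_bounded hbdd _ _
  simp only [hc, integral_zero] at hlim
  exact tendsto_nhds_unique tendsto_const_nhds hlim

-- At real `z` the transform is a planar Fourier integral and entire in `s`. Zeros accumulating at
-- `s = 0` force it to vanish for every `s`, so Fourier uniqueness applies to the part of `p` beyond
-- `r - η`.
open Filter Topology in
theorem ae_eq_zero_of_frequently_edgeTransform_le (hp : Integrable p)
    (hpρ : ∀ ξ, p ξ ≠ 0 → ‖ξ‖ ≤ ρ) {M : ℝ}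
    (h : ∃ᶠ s : ℝ in 𝓝[≠] 0, ∀ z : ℂ, 0 < z.im →
      ‖edgeTransform p r s z‖ ≤ M * Real.exp (-(2 * Real.pi * η) * z.im)) :
    ∀ᵐ ξ : EuclideanSpace ℝ (Fin 2), r - η < ξ 0 → p ξ = 0 := by
  set S : Set (EuclideanSpace ℝ (Fin 2)) := {ξ | r - η < ξ 0} with hS
  have hSm : MeasurableSet S := measurableSet_lt measurable_const (by fun_prop)
  set p₁ := S.indicator p with hp₁
  have hp₁i : Integrable p₁ := hp.indicator hSm
  have hp₁ρ : ∀ ξ, p₁ ξ ≠ 0 → ‖ξ‖ ≤ ρ := fun ξ hξ => by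
    have h1 := Set.mem_of_indicator_ne_zero hξ
    exact hpρ ξ (by simpa [hp₁, h1] using hξ)
  have h0 : ∀ z : ℂ, ∃ᶠ s : ℝ in 𝓝[≠] 0, edgeTransform p₁ (r - η) s z = 0 := fun z =>
    h.mono fun s hs => edgeTransform_indicator_eq_zero hp hpρ hs z
  have hvan : ∀ a b : ℝ, ∫ ξ, p₁ ξ * Complex.exp (2 * Real.pi * a * ξ 0 * Complex.I) *
      Complex.exp (2 * Real.pi * b * Complex.I * ((ξ 1 : ℝ) : ℂ)) = 0 := by
    intro a b
    set G : ℂ → ℂ := fun w => ∫ ξ, p₁ ξ * Complex.exp (2 * Real.pi * a * ξ 0 * Complex.I) *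
      Complex.exp (w * ((ξ 1 : ℝ) : ℂ)) with hG
    have hGd : Differentiable ℂ G := by
      refine differentiable_integral_mul_cexp (integrable_mul_cexp_I hp₁i a 0)
        (L := fun ξ => ξ 1) (Measurable.aemeasurable (by fun_prop)) (B := ρ) ?_
      intro ξ hξ
      simpa using abs_sub_coord_le hp₁ρ 0 1 ξ (left_ne_zero_of_mul hξ)
    set H : ℂ → ℂ := fun w => G (2 * Real.pi * Complex.I * w) with hH
    have hHd : Differentiable ℂ H := hGd.comp (by fun_prop)
    have hHz : ∃ᶠ s : ℝ in 𝓝[≠] 0, H s = 0 := by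
      refine (h0 (-a)).mono fun s hs => ?_
      have e : edgeTransform p₁ (r - η) s (-a)
          = Complex.exp (-(2 * Real.pi * Complex.I * a * (r - η))) * H s := by
        rw [hH, hG]
        simp only [edgeTransform]
        rw [← integral_const_mul]
        congr 1; ext ξ
        simp only [mul_assoc, mul_left_comm _ (p₁ ξ), ← Complex.exp_add]
        congr 2; push_cast; ring
      rw [e] at hs
      exact (mul_eq_zero.1 hs).resolve_left (Complex.exp_ne_zero _)
    have htend : Tendsto (fun s : ℝ => (s : ℂ)) (𝓝[≠] 0) (𝓝[≠] 0) := by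
      refine tendsto_nhdsWithin_iff.2 ⟨?_, ?_⟩
      · exact (Complex.continuous_ofReal.tendsto' 0 0 (by simp)).mono_left nhdsWithin_le_nhds
      · filter_upwards [self_mem_nhdsWithin] with s hs
        simpa using hs
    have hHC : ∃ᶠ w : ℂ in 𝓝[≠] 0, H w = 0 := htend.frequently hHz
    have hHa : AnalyticOnNhd ℂ H Set.univ := fun w _ => hHd.analyticAt w
    have hH0 := hHa.eqOn_zero_of_preconnected_of_frequently_eq_zero isPreconnected_univ (Set.mem_univ 0) hHC
    have := hH0 (Set.mem_univ (b : ℂ))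
    simp only [hH, hG, Pi.zero_apply] at this
    rw [← this]
    congr 1; ext ξ; congr 2; ring
  have hF : ∀ ξ, 𝓕 p₁ ξ = 0 := by
    intro y
    rw [Real.fourier_eq', ← hvan (-y 0) (-y 1)]
    congr 1; ext ξ
    rw [smul_eq_mul, mul_comm, mul_assoc (p₁ ξ), ← Complex.exp_add]
    congr 2
    simp [PiLp.inner_apply, Fin.sum_univ_two]
    ring
  filter_upwards [ae_eq_zero_of_fourier_eq_zero hp₁i hF] with ξ hξ hξS
  have : ξ ∈ S := hξS
  simpa [hp₁, this] using hξ

open Filter Topology in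
/-- A two-dimensional Titchmarsh theorem at the edge `ξ 0 = r`: if the product of the edge
transforms decays exponentially, one of the factors vanishes near the edge. -/
theorem ae_eq_zero_of_edgeTransform_mul_le (hp : Integrable p) (hq : Integrable q)
    (hpρ : ∀ ξ, p ξ ≠ 0 → ‖ξ‖ ≤ ρ) (hqρ : ∀ ξ, q ξ ≠ 0 → ‖ξ‖ ≤ ρ)
    (hpr : ∀ ξ, p ξ ≠ 0 → ξ 0 ≤ r) (hqr : ∀ ξ, q ξ ≠ 0 → ξ 0 ≤ r) {N δ : ℝ} (hδ : 0 < δ)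
    (hpq : ∀ (s : ℝ) (z : ℂ), 0 ≤ z.im →
      ‖edgeTransform p r s z * edgeTransform q r s z‖ ≤ N * Real.exp (-δ * z.im)) :
    ∃ η > 0, (∀ᵐ ξ : EuclideanSpace ℝ (Fin 2), r - η < ξ 0 → p ξ = 0) ∨
      (∀ᵐ ξ : EuclideanSpace ℝ (Fin 2), r - η < ξ 0 → q ξ = 0) := by
  have hπ := Real.pi_pos
  -- The decay rate `δ / 4` of the surviving factor, rewritten as `2πη`.
  refine ⟨δ / 4 / (2 * Real.pi), by positivity, ?_⟩
  have eη : 2 * Real.pi * (δ / 4 / (2 * Real.pi)) = δ / 4 := by field_simp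
  set A := (∫ ξ, ‖p ξ‖) + 1 with hA
  set B := (∫ ξ, ‖q ξ‖) + 1 with hB
  have hA0 : 0 < A := by
    have : 0 ≤ ∫ ξ, ‖p ξ‖ := integral_nonneg fun _ => norm_nonneg _
    linarith
  have hB0 : 0 < B := by
    have : 0 ≤ ∫ ξ, ‖q ξ‖ := integral_nonneg fun _ => norm_nonneg _
    linarith
  have hone : ∀ {f : EuclideanSpace ℝ (Fin 2) → ℂ} {D : ℝ}, 0 < D → (∫ ξ, ‖f ξ‖) + 1 = D →
      Integrable f → (∀ ξ, f ξ ≠ 0 → ξ 0 ≤ r) → ∀ (s : ℝ) (z : ℂ), 0 ≤ z.im →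
      ‖edgeTransform f r s z / D‖ ≤ 1 := by
    intro f D hD hfD hf hfr s z hz
    rw [norm_div, Complex.norm_real, Real.norm_eq_abs, abs_of_pos hD, div_le_one hD, ← hfD]
    have := norm_edgeTransform_le (r := r) (s := s) hf (z := z)
      (fun ξ hξ => mul_nonneg hz (by linarith [hfr ξ hξ]))
    linarith
  have hs : ∀ s : ℝ,
      (∀ z : ℂ, 0 < z.im → ‖edgeTransform p r s z‖ ≤
        A * Real.exp (-(2 * Real.pi * (δ / 4 / (2 * Real.pi))) * z.im)) ∨
      (∀ z : ℂ, 0 < z.im → ‖edgeTransform q r s z‖ ≤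
        B * Real.exp (-(2 * Real.pi * (δ / 4 / (2 * Real.pi))) * z.im)) := by
    intro s
    rw [eη]
    have key := exp_decay_of_mul_exp_decay
      ((differentiable_edgeTransform hp hpρ r s).div_const (A : ℂ))
      ((differentiable_edgeTransform hq hqρ r s).div_const (B : ℂ))
      (hone hA0 hA.symm hp hpr s) (hone hB0 hB.symm hq hqr s) hδ
      (N := Real.log (|N| / (A * B) + 1)) (by
        intro z hz
        have h1 : ‖edgeTransform p r s z / A * (edgeTransform q r s z / B)‖
            = ‖edgeTransform p r s z * edgeTransform q r s z‖ / (A * B) := by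
          rw [div_mul_div_comm, norm_div]
          simp [abs_of_pos hA0, abs_of_pos hB0]
        rw [h1, sub_eq_add_neg, Real.exp_add, Real.exp_log (by positivity), ← neg_mul]
        calc _ ≤ N * Real.exp (-δ * z.im) / (A * B) := by gcongr; exact hpq s z hz
          _ ≤ |N| * Real.exp (-δ * z.im) / (A * B) := by gcongr; exact le_abs_self N
          _ = |N| / (A * B) * Real.exp (-δ * z.im) := by ring
          _ ≤ _ := by gcongr; linarith)
    refine key.imp (fun h z hz => ?_) (fun h z hz => ?_)
    · have := h z hz
      rwa [norm_div, Complex.norm_real, Real.norm_eq_abs, abs_of_pos hA0, div_le_iff₀' hA0] at this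
    · have := h z hz
      rwa [norm_div, Complex.norm_real, Real.norm_eq_abs, abs_of_pos hB0, div_le_iff₀' hB0] at this
  -- Which factor decays may depend on `s`; one of them does so for `s` accumulating at `0`.
  have hfreq := frequently_or_distrib.1
    (Eventually.frequently (f := 𝓝[≠] (0 : ℝ)) (Eventually.of_forall hs))
  exact hfreq.imp (ae_eq_zero_of_frequently_edgeTransform_le hp hpρ)
    (ae_eq_zero_of_frequently_edgeTransform_le hq hqρ)

end SignRetrieval

/-! ### Symmetry, continuity and outer radius of the windows. -/

namespace SignRetrieval

theorem angularWindow_add_one (ν : ℝ → ℝ) (j ℓ : ℕ) (θ : ℝ) :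
    angularWindow ν j ℓ (θ + 1) = angularWindow ν j ℓ θ := by
  unfold angularWindow
  rw [← (Equiv.addRight (1 : ℤ)).tsum_eq (fun m : ℤ => ν (2 ^ j * (θ + m) - ℓ / 2))]
  congr 1; ext m
  simp only [Equiv.coe_addRight]
  push_cast
  ring_nf

theorem turn_neg {ξ : EuclideanSpace ℝ (Fin 2)} (hξ : ξ ≠ 0) :
    turn (-ξ) = turn ξ + 1 / 2 ∨ turn (-ξ) = turn ξ - 1 / 2 := by
  have hπ := Real.pi_pos
  set z : ℂ := ⟨ξ 0, ξ 1⟩ with hz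
  have hz0 : z ≠ 0 := by
    intro h
    apply hξ
    have h0 : ξ 0 = 0 := congrArg Complex.re h
    have h1 : ξ 1 = 0 := congrArg Complex.im h
    ext i; fin_cases i <;> simpa
  have hneg : (⟨(-ξ) 0, (-ξ) 1⟩ : ℂ) = -z := by simp [hz, Complex.ext_iff]
  have key : (-z).arg = z.arg + Real.pi ∨ (-z).arg = z.arg - Real.pi := by
    rcases lt_trichotomy z.im 0 with h | h | h
    · exact Or.inl (Complex.arg_neg_eq_arg_add_pi_of_im_neg h)
    · rcases lt_or_ge z.re 0 with h' | h'
      · right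
        rw [Complex.arg_eq_pi_iff.2 ⟨h', h⟩, sub_self]
        exact Complex.arg_eq_zero_iff.2 ⟨by simpa using h'.le, by simp [h]⟩
      · left
        have h'' : 0 < z.re := lt_of_le_of_ne h' fun h0 => hz0 (Complex.ext h0.symm h)
        rw [Complex.arg_eq_zero_iff.2 ⟨h', h⟩, zero_add]
        exact Complex.arg_eq_pi_iff.2 ⟨by simpa using h'', by simp [h]⟩
    · exact Or.inr (Complex.arg_neg_eq_arg_sub_pi_of_im_pos h)
  unfold turn
  rw [hneg, ← hz]
  rcases key with h | h
  · left; rw [h]; field_simp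
  · right; rw [h]; field_simp

variable {ν w : ℝ → ℝ} {χ₀ : EuclideanSpace ℝ (Fin 2) → ℝ}

/-- The map `ξ ↦ -ξ` shifts the angle by half a turn, which swaps the two angular terms. This
evenness makes the curvelets real. -/
theorem window_neg (hχ₀ : ∀ ξ, χ₀ (-ξ) = χ₀ ξ) (j ℓ : ℕ) (ξ : EuclideanSpace ℝ (Fin 2)) :
    window ν w χ₀ j ℓ (-ξ) = window ν w χ₀ j ℓ ξ := by
  rcases eq_or_ne ξ 0 with rfl | hξ
  · simp
  unfold window
  split_ifs with hj
  · exact hχ₀ ξ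
  · rw [norm_neg]
    congr 1
    rcases turn_neg hξ with h | h
    · rw [h, show turn ξ + 1 / 2 + 1 / 2 = turn ξ + 1 by ring, angularWindow_add_one, add_comm]
    · rw [h, ← angularWindow_add_one ν j ℓ (turn ξ - 1 / 2),
        show turn ξ - 1 / 2 + 1 = turn ξ + 1 / 2 by ring,
        show turn ξ - 1 / 2 + 1 / 2 = turn ξ by ring, add_comm]

/-- The inverse Fourier transform of a real even function is real. -/
theorem fourierInv_ofReal_im_eq_zero {V : Type*} [NormedAddCommGroup V] [InnerProductSpace ℝ V]
    [FiniteDimensional ℝ V] [MeasurableSpace V] [BorelSpace V] {g : V → ℝ}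
    (hg : ∀ ξ, g (-ξ) = g ξ) (x : V) : (𝓕⁻ (fun ξ => (g ξ : ℂ)) x).im = 0 := by
  rw [← Complex.conj_eq_iff_im, Real.fourierInv_eq', ← integral_conj, ← integral_neg_eq_self]
  congr 1; ext ξ
  rw [hg, smul_eq_mul, smul_eq_mul, map_mul, ← Complex.exp_conj, Complex.conj_ofReal]
  congr 2
  simp only [map_mul, Complex.conj_ofReal, Complex.conj_I, inner_neg_left]
  push_cast
  ring

theorem generator_im (h : IsCurveletTriple ν w χ₀) (j : ℕ) (x : EuclideanSpace ℝ (Fin 2)) :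
    (generator ν w χ₀ j x).im = 0 :=
  fourierInv_ofReal_im_eq_zero (fun ξ => by rw [window_neg h.low_even]) x

theorem curveletSystem_im (h : IsCurveletTriple ν w χ₀) (α₁ α₂ : ℝ)
    (i : Σ j : ℕ, Fin (2 ^ j) × ℤ × ℤ) (x : EuclideanSpace ℝ (Fin 2)) :
    (curveletSystem ν w χ₀ α₁ α₂ i x).im = 0 :=
  generator_im h _ _

namespace IsCurveletTriple

variable (h : IsCurveletTriple ν w χ₀)
include h

/-- Continuity gives the endpoints `±1/2`, which the support condition leaves open; the value at
`-1/2` is what makes `ν 0` nonzero. -/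
theorem nu_eq_zero {θ : ℝ} (hθ : 1 / 2 ≤ |θ|) : ν θ = 0 := by
  have hright : ∀ t : ℝ, 1 / 2 ≤ t → ν t = 0 := by
    have hc : IsClosed {t : ℝ | ν t = 0} := isClosed_eq h.nu_smooth.continuous continuous_const
    have hsub : Set.Ioi (1 / 2 : ℝ) ⊆ {t : ℝ | ν t = 0} := by
      intro t ht
      by_contra h0
      have := (h.nu_support h0).2
      exact absurd ht (not_lt.2 this)
    have := hc.closure_subset_iff.2 hsub
    rw [closure_Ioi] at this
    exact fun t ht => this ht
  rcases le_abs'.1 hθ with h1 | h1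
  · rw [← h.nu_even]; exact hright _ (by linarith)
  · exact hright _ h1

theorem nu_zero_ne_zero : ν 0 ≠ 0 := by
  intro h0
  have h1 := h.nu_partition 0 ⟨le_rfl, by norm_num⟩
  rw [h0, h.nu_eq_zero (by norm_num)] at h1
  norm_num at h1

/-- For `|t| ≤ 1/2` only `m = 0` survives in the first periodization, and only `m = 0, -1` in the
second. -/
theorem angularWindow_one_eq {t : ℝ} (ht : |t| ≤ 1 / 2) :
    angularWindow ν 1 0 t + angularWindow ν 1 0 (t + 1 / 2)
      = ν (2 * t) + (ν (2 * t + 1) + ν (2 * t - 1)) := by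
  obtain ⟨ht1, ht2⟩ := abs_le.1 ht
  congr 1
  · unfold angularWindow
    rw [tsum_eq_single 0]
    · congr 1; norm_num
    · intro m hm
      apply h.nu_eq_zero
      rw [le_abs']
      rcases lt_or_gt_of_ne hm with h1 | h1
      · have : (m : ℝ) ≤ -1 := by exact_mod_cast Int.le_sub_one_of_lt h1
        left; norm_num; linarith
      · have : (1 : ℝ) ≤ m := by exact_mod_cast h1
        right; norm_num; linarith
  · unfold angularWindow
    rw [tsum_eq_sum (s := {0, -1})]
    · rw [Finset.sum_pair (by norm_num)]
      congr 2 <;> (push_cast; ring)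
    · intro m hm
      simp only [Finset.mem_insert, Finset.mem_singleton, not_or] at hm
      apply h.nu_eq_zero
      rw [le_abs']
      rcases lt_or_gt_of_ne hm.1 with h1 | h1
      · have h2 : m ≤ -2 := by have := hm.2; omega
        have : (m : ℝ) ≤ -2 := by exact_mod_cast h2
        left; norm_num; linarith
      · have : (1 : ℝ) ≤ m := by exact_mod_cast h1
        right; norm_num; linarith

theorem window_one_eq (ξ : EuclideanSpace ℝ (Fin 2)) :
    window ν w χ₀ 1 0 ξ =
      w (‖ξ‖ / 4) * (ν (2 * turn ξ) + (ν (2 * turn ξ + 1) + ν (2 * turn ξ - 1))) := by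
  have hπ := Real.pi_pos
  have ht : |turn ξ| ≤ 1 / 2 := by
    unfold turn
    rw [abs_div, abs_of_pos (by positivity : (0 : ℝ) < 2 * Real.pi), div_le_iff₀ (by positivity)]
    have := Complex.abs_arg_le_pi ⟨ξ 0, ξ 1⟩
    linarith
  rw [← h.angularWindow_one_eq ht]
  norm_num [window]

/-- The angle jumps only across the negative first axis, where evenness carries continuity over from
the opposite point. Near the origin the radial factor vanishes. -/
theorem continuous_window_one : Continuous (window ν w χ₀ 1 0) := by
  have hν := h.nu_smooth.continuous
  have hw := h.w_smooth.continuous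
  have hslit : ∀ ξ : EuclideanSpace ℝ (Fin 2), (⟨ξ 0, ξ 1⟩ : ℂ) ∈ Complex.slitPlane →
      ContinuousAt (window ν w χ₀ 1 0) ξ := by
    intro ξ hξ
    have hz : ContinuousAt (fun ξ : EuclideanSpace ℝ (Fin 2) => (⟨ξ 0, ξ 1⟩ : ℂ)) ξ := by
      have e : (fun ξ : EuclideanSpace ℝ (Fin 2) => (⟨ξ 0, ξ 1⟩ : ℂ))
          = fun ξ => (ξ 0 : ℂ) + ξ 1 * Complex.I := by
        ext ξ; exact Complex.mk_eq_add_mul_I _ _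
      rw [e]; fun_prop
    have ht : ContinuousAt turn ξ :=
      ((Complex.continuousAt_arg hξ).comp (f := fun ξ : EuclideanSpace ℝ (Fin 2) =>
        (⟨ξ 0, ξ 1⟩ : ℂ)) hz).div_const _
    rw [funext h.window_one_eq]
    fun_prop
  refine continuous_iff_continuousAt.2 fun ξ => ?_
  rcases eq_or_ne ξ 0 with rfl | hξ
  · have h0 : (fun _ => (0 : ℝ)) =ᶠ[nhds 0] window ν w χ₀ 1 0 := by
      filter_upwards [Metric.ball_mem_nhds (0 : EuclideanSpace ℝ (Fin 2)) one_pos] with ξ hξ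
      have hw0 : w (‖ξ‖ / 4) = 0 := by
        by_contra h1
        have := (h.w_support h1).1
        have : ‖ξ‖ < 1 := by simpa using hξ
        linarith
      rw [h.window_one_eq, hw0, zero_mul]
    exact (continuousAt_const).congr h0
  by_cases hs : (⟨ξ 0, ξ 1⟩ : ℂ) ∈ Complex.slitPlane
  · exact hslit ξ hs
  · have hs' : (⟨(-ξ) 0, (-ξ) 1⟩ : ℂ) ∈ Complex.slitPlane := by
      simp only [Complex.mem_slitPlane_iff, not_or, not_lt, not_not] at hs ⊢
      left
      have h1 : ξ 0 ≠ 0 := by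
        intro h0; apply hξ
        ext i; fin_cases i
        · simpa using h0
        · simpa using hs.2
      have := lt_of_le_of_ne hs.1 h1
      simpa using this
    have e : window ν w χ₀ 1 0 = fun ξ => window ν w χ₀ 1 0 (-ξ) := by
      ext ξ; exact (window_neg h.low_even _ _ _).symm
    rw [e]
    exact (hslit (-ξ) hs').comp (f := fun ξ => -ξ) continuousAt_neg

/-- Otherwise the tiling sum would be zero at any point outside the support of `χ₀`. -/
theorem exists_w_ne_zero : ∃ r, w r ≠ 0 := by
  by_contra! hw
  obtain ⟨R, hR⟩ := h.low_support
  have ht := h.tiling (EuclideanSpace.single 0 (|R| + 1))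
  have hχ : χ₀ (EuclideanSpace.single 0 (|R| + 1)) = 0 := by
    by_contra h0
    have h1 := hR h0
    rw [mem_closedBall_zero_iff, PiLp.norm_single, Real.norm_eq_abs,
      abs_of_pos (by positivity)] at h1
    linarith [le_abs_self R]
  have h0 : (fun j : ℕ => ∑ ℓ ∈ Finset.range (2 ^ j),
      window ν w χ₀ j ℓ (EuclideanSpace.single 0 (|R| + 1)) ^ 2) = fun _ => 0 := by
    ext j
    refine Finset.sum_eq_zero fun ℓ _ => ?_
    unfold window
    split_ifs <;> simp [hχ, hw]
  rw [h0] at ht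
  exact zero_ne_one (hasSum_zero.unique ht)

theorem window_one_axis_ne_zero {t : ℝ} (ht : w t ≠ 0) :
    window ν w χ₀ 1 0 (EuclideanSpace.single 0 (4 * t)) ≠ 0 := by
  have ht0 : 0 < t := by linarith [(h.w_support ht).1]
  have hturn : turn (EuclideanSpace.single 0 (4 * t)) = 0 := by
    unfold turn
    rw [Complex.arg_eq_zero_iff.2 ⟨by simpa using ht0.le, by simp⟩, zero_div]
  rw [h.window_one_eq, hturn, PiLp.norm_single, Real.norm_eq_abs,
    abs_of_pos (by positivity), h.nu_eq_zero (θ := 2 * 0 + 1) (by norm_num),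
    h.nu_eq_zero (θ := 2 * 0 - 1) (by norm_num)]
  simpa [ht] using h.nu_zero_ne_zero

/-- The outer radius of the support of the window `χ_{1,0}`, attained along the first axis. -/
theorem exists_outer_radius : ∃ r : ℝ, 0 < r ∧ r ≤ 32 / 3 ∧
    (∀ ξ, window ν w χ₀ 1 0 ξ ≠ 0 → ‖ξ‖ ≤ r) ∧
    ∀ η > 0, ∃ t > r - η, window ν w χ₀ 1 0 (EuclideanSpace.single 0 t) ≠ 0 := by
  obtain ⟨t₀, ht₀⟩ := h.exists_w_ne_zero
  have hbdd : BddAbove (Function.support w) := ⟨8 / 3, fun t ht => (h.w_support ht).2⟩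
  have hne : (Function.support w).Nonempty := ⟨t₀, ht₀⟩
  -- The factor `4` is `2 ^ (2 * j)` at `j = 1`, and `4 * (8 / 3) = 32 / 3`.
  refine ⟨4 * sSup (Function.support w), ?_, ?_, fun ξ hξ => ?_, fun η hη => ?_⟩
  · have h1 := le_csSup hbdd ht₀
    have h2 := (h.w_support ht₀).1
    linarith
  · have := csSup_le hne (fun t ht => (h.w_support ht).2)
    linarith
  · rw [h.window_one_eq] at hξ
    have := le_csSup hbdd (left_ne_zero_of_mul hξ : ‖ξ‖ / 4 ∈ Function.support w)
    linarith
  · obtain ⟨t, ht, hlt⟩ := exists_lt_of_lt_csSup hne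
      (show sSup (Function.support w) - η / 4 < sSup (Function.support w) by linarith)
    exact ⟨4 * t, by linarith, h.window_one_axis_ne_zero ht⟩

end IsCurveletTriple

end SignRetrieval

/-! ### Convolution, lattice sampling and the cap free of aliasing. -/

namespace SignRetrieval

variable {p q K : EuclideanSpace ℝ (Fin 2) → ℂ} {r : ℝ}

/-- The convolution of two functions on the plane. -/
noncomputable def conv (p q : EuclideanSpace ℝ (Fin 2) → ℂ) : EuclideanSpace ℝ (Fin 2) → ℂ :=
  convolution p q (ContinuousLinearMap.mul ℂ ℂ) volume

theorem conv_apply (p q : EuclideanSpace ℝ (Fin 2) → ℂ) (ζ : EuclideanSpace ℝ (Fin 2)) :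
    conv p q ζ = ∫ ξ, p ξ * q (ζ - ξ) := rfl

theorem hasCompactSupport_of_norm_le {p : EuclideanSpace ℝ (Fin 2) → ℂ}
    (hpr : ∀ ξ, p ξ ≠ 0 → ‖ξ‖ ≤ r) : HasCompactSupport p :=
  HasCompactSupport.of_support_subset_isCompact (isCompact_closedBall 0 r)
    fun ξ hξ => mem_closedBall_zero_iff.2 (hpr ξ hξ)

theorem continuous_conv (hp : Continuous p) (hq : Continuous q)
    (hqr : ∀ ξ, q ξ ≠ 0 → ‖ξ‖ ≤ r) : Continuous (conv p q) :=
  (hasCompactSupport_of_norm_le hqr).continuous_convolution_right _ hp.locallyIntegrable hq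

theorem norm_le_of_conv_ne_zero (hpr : ∀ ξ, p ξ ≠ 0 → ‖ξ‖ ≤ r) (hqr : ∀ ξ, q ξ ≠ 0 → ‖ξ‖ ≤ r)
    (ζ : EuclideanSpace ℝ (Fin 2)) (hζ : conv p q ζ ≠ 0) : ‖ζ‖ ≤ 2 * r := by
  by_contra! hlt
  apply hζ
  rw [conv_apply]
  refine integral_eq_zero_of_ae (Filter.Eventually.of_forall fun ξ => ?_)
  by_contra h0
  have h1 := hpr ξ (left_ne_zero_of_mul h0)
  have h2 := hqr (ζ - ξ) (right_ne_zero_of_mul h0)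
  have h3 := norm_add_le ξ (ζ - ξ)
  rw [add_sub_cancel] at h3
  linarith

/-- The transform of a convolution against a multiplicative function factors. -/
theorem integral_conv_mul (hp : Continuous p) (hq : Continuous q)
    (hpr : ∀ ξ, p ξ ≠ 0 → ‖ξ‖ ≤ r) (hqr : ∀ ξ, q ξ ≠ 0 → ‖ξ‖ ≤ r)
    {u : EuclideanSpace ℝ (Fin 2) → ℂ} (hu : Continuous u) (hmul : ∀ ξ η, u (ξ + η) = u ξ * u η) :
    ∫ ζ, conv p q ζ * u ζ = (∫ ξ, p ξ * u ξ) * ∫ ξ, q ξ * u ξ := by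
  have hpu : Integrable (fun ξ => p ξ * u ξ) := (hp.mul hu).integrable_of_hasCompactSupport
    (hasCompactSupport_of_norm_le hpr).mul_right
  have hqu : Integrable (fun ξ => q ξ * u ξ) := (hq.mul hu).integrable_of_hasCompactSupport
    (hasCompactSupport_of_norm_le hqr).mul_right
  have key := integral_convolution (L := ContinuousLinearMap.mul ℂ ℂ) hpu hqu
  rw [ContinuousLinearMap.mul_apply'] at key
  rw [← key]
  congr 1; ext ζ
  rw [conv_apply, ← integral_mul_const]
  change _ = ∫ ξ, (p ξ * u ξ) * (q (ζ - ξ) * u (ζ - ξ))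
  congr 1; ext ξ
  have : u ζ = u ξ * u (ζ - ξ) := by rw [← hmul, add_sub_cancel]
  rw [this]; ring

/-- The exponentials are multiplicative in `ξ`, and the two edges at `r` add up to one at `2 * r`.
-/
theorem edgeTransform_conv (hp : Continuous p) (hq : Continuous q)
    (hpr : ∀ ξ, p ξ ≠ 0 → ‖ξ‖ ≤ r) (hqr : ∀ ξ, q ξ ≠ 0 → ‖ξ‖ ≤ r) (s : ℝ) (z : ℂ) :
    edgeTransform p r s z * edgeTransform q r s z = edgeTransform (conv p q) (2 * r) s z := by
  set u : EuclideanSpace ℝ (Fin 2) → ℂ := fun ξ =>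
    Complex.exp (2 * Real.pi * Complex.I * (s * ξ 1 - z * ξ 0)) with hu
  have huc : Continuous u := by rw [hu]; fun_prop
  have hum : ∀ ξ η, u (ξ + η) = u ξ * u η := by
    intro ξ η
    simp only [hu, ← Complex.exp_add, PiLp.add_apply]
    congr 1; push_cast; ring
  have he : ∀ (f : EuclideanSpace ℝ (Fin 2) → ℂ) (t : ℝ), edgeTransform f t s z
      = (∫ ξ, f ξ * u ξ) * Complex.exp (2 * Real.pi * Complex.I * z * t) := by
    intro f t
    unfold edgeTransform
    rw [← integral_mul_const]
    congr 1; ext ξ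
    simp only [hu, mul_assoc (f ξ), ← Complex.exp_add]
    congr 2; push_cast; ring
  rw [he, he, he, integral_conv_mul hp hq hpr hqr huc hum]
  have : Complex.exp (2 * Real.pi * Complex.I * z * (2 * r : ℝ))
      = Complex.exp (2 * Real.pi * Complex.I * z * r) *
        Complex.exp (2 * Real.pi * Complex.I * z * r) := by
    rw [← Complex.exp_add]; congr 1; push_cast; ring
  rw [this]; ring

/-- The class of a point of the plane modulo the lattice dual to the sampling lattice. -/
noncomputable def torusMk (τ : Fin 2 → ℝ) (ζ : EuclideanSpace ℝ (Fin 2)) : UnitAddTorus (Fin 2) :=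
  fun i => ((τ i * ζ i : ℝ) : UnitAddCircle)

theorem continuous_torusMk (τ : Fin 2 → ℝ) : Continuous (torusMk τ) :=
  continuous_pi fun i => (AddCircle.continuous_mk' 1).comp (by fun_prop)

/-- Trigonometric monomials span a dense subspace of the continuous functions on the torus, and
integration against `K` is a continuous functional there. -/
theorem integral_mul_comp_torusMk_eq_zero (hK : Integrable K) (τ : Fin 2 → ℝ)
    (h : ∀ k : Fin 2 → ℤ, ∫ ζ, K ζ * Complex.exp
      (2 * Real.pi * Complex.I * (τ 0 * k 0 * ζ 0 + τ 1 * k 1 * ζ 1)) = 0)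
    (φ : C(UnitAddTorus (Fin 2), ℂ)) : ∫ ζ, K ζ * φ (torusMk τ ζ) = 0 := by
  have hint : ∀ φ : C(UnitAddTorus (Fin 2), ℂ), Integrable (fun ζ => K ζ * φ (torusMk τ ζ)) :=
    fun φ => hK.mul_bdd (c := ‖φ‖)
      (φ.continuous.comp (continuous_torusMk τ)).aestronglyMeasurable
      (Filter.Eventually.of_forall fun ζ => φ.norm_coe_le_norm _)
  let Λ : C(UnitAddTorus (Fin 2), ℂ) →ₗ[ℂ] ℂ :=
    { toFun := fun φ => ∫ ζ, K ζ * φ (torusMk τ ζ)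
      map_add' := fun φ ψ => by
        rw [← integral_add (hint φ) (hint ψ)]
        congr 1; ext ζ; simp [mul_add]
      map_smul' := fun c φ => by
        rw [RingHom.id_apply, smul_eq_mul, ← integral_const_mul]
        congr 1; ext ζ; simp [mul_left_comm] }
  let Λc : C(UnitAddTorus (Fin 2), ℂ) →L[ℂ] ℂ := Λ.mkContinuous (∫ ζ, ‖K ζ‖) fun φ => by
    change ‖∫ ζ, K ζ * φ (torusMk τ ζ)‖ ≤ _
    rw [← integral_mul_const]
    refine (norm_integral_le_integral_norm _).trans (integral_mono (hint φ).norm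
      (hK.norm.mul_const _) fun ζ => ?_)
    simp only [norm_mul]
    gcongr
    exact φ.norm_coe_le_norm _
  have hspan : Submodule.span ℂ (Set.range (UnitAddTorus.mFourier (d := Fin 2)))
      ≤ LinearMap.ker Λc.toLinearMap := by
    rw [Submodule.span_le]
    rintro _ ⟨k, rfl⟩
    change ∫ ζ, K ζ * UnitAddTorus.mFourier k (torusMk τ ζ) = 0
    rw [← h k]
    congr 1; ext ζ
    congr 1
    change ∏ i, fourier (k i) (torusMk τ ζ i) = _
    rw [Fin.prod_univ_two]
    simp only [torusMk, fourier_coe_apply, ← Complex.exp_add]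
    congr 1; push_cast; ring
  have htop := Submodule.topologicalClosure_minimal _ hspan Λc.isClosed_ker
  rw [UnitAddTorus.span_mFourier_closure_eq_top] at htop
  exact htop (Submodule.mem_top (x := φ))

/-- A continuous function whose Fourier coefficients over a lattice vanish is zero on every open
set whose translates by the dual lattice miss its support. -/
theorem eq_zero_of_lattice_coeff_eq_zero (hK : Continuous K) (hKc : HasCompactSupport K)
    {τ : Fin 2 → ℝ} (hτ : ∀ i, 0 < τ i)
    (h : ∀ k : Fin 2 → ℤ, ∫ ζ, K ζ * Complex.exp
      (2 * Real.pi * Complex.I * (τ 0 * k 0 * ζ 0 + τ 1 * k 1 * ζ 1)) = 0)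
    {U : Set (EuclideanSpace ℝ (Fin 2))} (hU : IsOpen U)
    (hUK : ∀ ζ ∈ U, ∀ ζ', (∀ i, ∃ n : ℤ, τ i * ζ' i = τ i * ζ i + n) → ζ' ≠ ζ → K ζ' = 0)
    {ζ₀ : EuclideanSpace ℝ (Fin 2)} (hζ₀ : ζ₀ ∈ U) : K ζ₀ = 0 := by
  by_contra hne
  -- On `W` the values of `K` have positive component along `K ζ₀`, so nothing cancels in an
  -- integral against a nonnegative bump.
  set W : Set (EuclideanSpace ℝ (Fin 2)) := U ∩ {ζ | 0 < (conj (K ζ₀) * K ζ).re} with hW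
  have hWo : IsOpen W := hU.inter (isOpen_lt continuous_const (by fun_prop))
  have hW0 : ζ₀ ∈ W := by
    refine ⟨hζ₀, ?_⟩
    simp only [Set.mem_ofPred_eq, Complex.conj_mul', ← Complex.ofReal_pow, Complex.ofReal_re]
    positivity
  obtain ⟨ε, hε, hball⟩ : ∃ ε > 0, ∀ ζ : EuclideanSpace ℝ (Fin 2),
      (∀ i, |τ i * (ζ i - ζ₀ i)| < ε) → ζ ∈ W := by
    have hopen : IsOpen ((fun x : Fin 2 → ℝ => WithLp.toLp 2 (fun i => x i / τ i + ζ₀ i)) ⁻¹' W) :=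
      hWo.preimage (by fun_prop)
    obtain ⟨ε, hε, hb⟩ := Metric.isOpen_iff.1 hopen 0 (by simpa using hW0)
    refine ⟨ε, hε, fun ζ hζ => ?_⟩
    have h1 : (fun i => τ i * (ζ i - ζ₀ i)) ∈ Metric.ball (0 : Fin 2 → ℝ) ε := by
      rw [mem_ball_zero_iff, pi_norm_lt_iff hε]
      exact hζ
    have h2 := hb h1
    simp only [Set.mem_preimage] at h2
    convert h2 using 1
    ext i
    have := (hτ i).ne'
    simp only
    field_simp
    ring
  -- A tent function around the class of `ζ₀`, so its pullback to the plane is lattice-periodic.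
  let φ : C(UnitAddTorus (Fin 2), ℂ) :=
    ⟨fun x => ((max 0 (ε - dist x (torusMk τ ζ₀)) : ℝ) : ℂ), by fun_prop⟩
  have hφ0 : ∀ ζ, φ (torusMk τ ζ)
      = ((max 0 (ε - dist (torusMk τ ζ) (torusMk τ ζ₀)) : ℝ) : ℂ) := fun ζ => rfl
  have hzero := integral_mul_comp_torusMk_eq_zero
    (hK.integrable_of_hasCompactSupport hKc) τ h φ
  set G : EuclideanSpace ℝ (Fin 2) → ℝ := fun ζ =>
    (conj (K ζ₀) * (K ζ * φ (torusMk τ ζ))).re with hG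
  have hGre : ∀ ζ, G ζ
      = (conj (K ζ₀) * K ζ).re * max 0 (ε - dist (torusMk τ ζ) (torusMk τ ζ₀)) := by
    intro ζ
    rw [hG]; simp only [hφ0, ← mul_assoc, Complex.re_mul_ofReal]
  have hφc : Continuous (fun ζ => φ (torusMk τ ζ)) := φ.continuous.comp (continuous_torusMk τ)
  have hKφc : HasCompactSupport (fun ζ => K ζ * φ (torusMk τ ζ)) := hKc.mul_right
  have hGc : Continuous G := Complex.continuous_re.comp (continuous_const.mul (hK.mul hφc))
  have hGs : HasCompactSupport G :=
    hKφc.comp_left (g := fun y => (conj (K ζ₀) * y).re) (by simp)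
  have hG0 : 0 ≤ G := by
    intro ζ
    simp only [Pi.zero_apply]
    rw [hGre]
    rcases le_or_gt ε (dist (torusMk τ ζ) (torusMk τ ζ₀)) with hd | hd
    · rw [max_eq_left (by linarith), mul_zero]
    -- The translate of `ζ` closest to `ζ₀`. It lies in `W`, so if `ζ` is a different translate then
    -- `K ζ = 0`.
    set ζ₁ : EuclideanSpace ℝ (Fin 2) :=
      WithLp.toLp 2 (fun i => ζ i - round (τ i * (ζ i - ζ₀ i)) / τ i) with hζ₁
    have h1 : ∀ i, τ i * ζ₁ i = τ i * ζ i - round (τ i * (ζ i - ζ₀ i)) := by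
      intro i
      have := (hτ i).ne'
      simp only [hζ₁]
      field_simp
    have hmem : ζ₁ ∈ W := by
      refine hball ζ₁ fun i => ?_
      have h2 := (dist_le_pi_dist (torusMk τ ζ) (torusMk τ ζ₀) i).trans_lt hd
      have e : torusMk τ ζ i - torusMk τ ζ₀ i
          = ((τ i * (ζ i - ζ₀ i) : ℝ) : UnitAddCircle) := by
        simp only [torusMk, ← AddCircle.coe_sub, mul_sub]
      rw [dist_eq_norm, e, UnitAddCircle.norm_eq] at h2
      rwa [mul_sub, h1, sub_right_comm, ← mul_sub]
    by_cases hζ : ζ = ζ₁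
    · rw [← hζ] at hmem
      exact mul_nonneg hmem.2.le (le_max_left _ _)
    · rw [hUK ζ₁ hmem.1 ζ (fun i => ⟨round (τ i * (ζ i - ζ₀ i)), by rw [h1]; ring⟩) hζ]
      simp
  have hpos : 0 < ∫ ζ, G ζ := by
    refine hGc.integral_pos_of_hasCompactSupport_nonneg_nonzero hGs hG0 (x := ζ₀) ?_
    rw [hGre, dist_self, sub_zero, max_eq_right hε.le]
    exact (mul_pos hW0.2 hε).ne'
  have hint : Integrable (fun ζ => conj (K ζ₀) * (K ζ * φ (torusMk τ ζ))) :=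
    ((hK.mul hφc).integrable_of_hasCompactSupport hKφc).const_mul _
  have : ∫ ζ, G ζ = (∫ ζ, conj (K ζ₀) * (K ζ * φ (torusMk τ ζ))).re := by
    rw [hG]; exact integral_re hint
  rw [this, integral_const_mul, hzero] at hpos
  simp at hpos

-- A radial limit from outside gives vanishing on the bounding circle as well. Only points of the
-- open disk then remain, which allows equality in `4 * r * τ 0 ≤ 1`.
open Filter Topology in
theorem eq_zero_of_two_mul_le_norm (hK : Continuous K) (hr : 0 < r)
    (hKr : ∀ ζ, K ζ ≠ 0 → ‖ζ‖ ≤ r) {ζ : EuclideanSpace ℝ (Fin 2)} (hζ : r ≤ ‖ζ‖) : K ζ = 0 := by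
  have h1 : Tendsto (fun t : ℝ => K (t • ζ)) (𝓝[>] 1) (𝓝 (K ζ)) := by
    have : Continuous (fun t : ℝ => K (t • ζ)) := by fun_prop
    exact (this.tendsto' 1 _ (by simp)).mono_left nhdsWithin_le_nhds
  refine tendsto_nhds_unique h1 (tendsto_const_nhds.congr' ?_)
  filter_upwards [self_mem_nhdsWithin] with t ht
  have ht1 : 1 < t := ht
  by_contra h0
  have h2 := hKr _ (Ne.symm h0)
  rw [norm_smul, Real.norm_eq_abs, abs_of_pos (by linarith)] at h2
  nlinarith

/-- Sampling at the edge: a function supported in a disk of diameter at most the first dual period,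
with vanishing lattice coefficients, vanishes on a cap of the disk. -/
theorem exists_cap_eq_zero (hK : Continuous K) (hr : 0 < r) (hKr : ∀ ζ, K ζ ≠ 0 → ‖ζ‖ ≤ 2 * r)
    {τ : Fin 2 → ℝ} (hτ : ∀ i, 0 < τ i) (hτr : 4 * r * τ 0 ≤ 1)
    (h : ∀ k : Fin 2 → ℤ, ∫ ζ, K ζ * Complex.exp
      (2 * Real.pi * Complex.I * (τ 0 * k 0 * ζ 0 + τ 1 * k 1 * ζ 1)) = 0) :
    ∃ δ > 0, ∀ ζ, K ζ ≠ 0 → ζ 0 ≤ 2 * r - δ := by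
  have hτ0 := hτ 0
  have hτ1 := hτ 1
  -- In the cap `(ζ 1)² < 4r² - (2r - δ)² ≤ 4rδ`, and the second bound on `δ` turns this into `|τ 1
  -- * ζ 1| < 1/2`. The bound `δ ≤ r` keeps `2r - δ` positive.
  set δ : ℝ := min r (1 / (16 * r * τ 1 ^ 2)) with hδ
  have hδ0 : 0 < δ := lt_min hr (by positivity)
  have hδr : δ ≤ r := min_le_left _ _
  have hδτ : 16 * r * δ * τ 1 ^ 2 ≤ 1 := by
    have h1 : δ ≤ 1 / (16 * r * τ 1 ^ 2) := min_le_right _ _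
    rw [le_div_iff₀ (by positivity)] at h1
    linarith
  have hsq : ∀ ζ : EuclideanSpace ℝ (Fin 2), ‖ζ‖ ^ 2 = ζ 0 ^ 2 + ζ 1 ^ 2 := by
    intro ζ
    rw [EuclideanSpace.real_norm_sq_eq, Fin.sum_univ_two]
  refine ⟨δ, hδ0, fun ζ₀ hne => ?_⟩
  by_contra! hcap
  apply hne
  rcases le_or_gt (2 * r) ‖ζ₀‖ with hn | hn
  · exact eq_zero_of_two_mul_le_norm hK (by positivity) hKr hn
  refine eq_zero_of_lattice_coeff_eq_zero hK (hasCompactSupport_of_norm_le hKr) hτ h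
    (U := {ζ | 2 * r - δ < ζ 0} ∩ {ζ | ‖ζ‖ < 2 * r})
    ((isOpen_lt continuous_const (by fun_prop)).inter (isOpen_lt (by fun_prop) continuous_const))
    ?_ ⟨hcap, hn⟩
  rintro ζ ⟨h1, h2⟩ ζ' hζ' hneq
  simp only [Set.mem_ofPred_eq] at h1 h2
  by_contra h0
  have h3 := hKr ζ' h0
  obtain ⟨n₀, hn₀⟩ := hζ' 0
  obtain ⟨n₁, hn₁⟩ := hζ' 1
  have hc : ζ 0 < 2 * r := by
    have := PiLp.norm_apply_le ζ 0
    rw [Real.norm_eq_abs] at this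
    linarith [le_abs_self (ζ 0)]
  have hc' : |ζ' 0| ≤ 2 * r := by
    have := PiLp.norm_apply_le ζ' 0
    rw [Real.norm_eq_abs] at this
    linarith
  obtain ⟨hc1, hc2⟩ := abs_le.1 hc'
  -- A nonzero horizontal shift has length at least `1 / τ 0 ≥ 4r` and leaves the disk.
  have hn₀' : n₀ = 0 := by
    by_contra hnz
    rcases lt_or_gt_of_ne hnz with hlt | hgt
    · have : (n₀ : ℝ) ≤ -1 := by exact_mod_cast Int.le_sub_one_of_lt hlt
      nlinarith
    · have : (1 : ℝ) ≤ n₀ := by exact_mod_cast hgt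
      nlinarith
  rw [hn₀', Int.cast_zero, add_zero] at hn₀
  have e0 : ζ' 0 = ζ 0 := mul_left_cancel₀ hτ0.ne' hn₀
  have hn₁' : n₁ ≠ 0 := by
    rintro rfl
    rw [Int.cast_zero, add_zero] at hn₁
    apply hneq
    ext i; fin_cases i
    · exact e0
    · exact mul_left_cancel₀ hτ1.ne' hn₁
  have hz0 : (2 * r - δ) ^ 2 < ζ 0 ^ 2 := by
    apply pow_lt_pow_left₀ h1 (by linarith) (by norm_num)
  have hbound : ∀ x : EuclideanSpace ℝ (Fin 2), ‖x‖ ≤ 2 * r → x 0 = ζ 0 →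
      |τ 1 * x 1| < 1 / 2 := by
    intro x hx hx0
    have hx2 : ‖x‖ ^ 2 ≤ (2 * r) ^ 2 := pow_le_pow_left₀ (norm_nonneg _) hx 2
    rw [hsq, hx0] at hx2
    have h5 : x 1 ^ 2 < 4 * r * δ := by nlinarith
    refine abs_lt_of_sq_lt_sq ?_ (by norm_num)
    rw [mul_pow]
    nlinarith [mul_lt_mul_of_pos_left h5 (by positivity : 0 < τ 1 ^ 2)]
  have hb1 := abs_lt.1 (hbound ζ h2.le rfl)
  have hb2 := abs_lt.1 (hbound ζ' h3 e0)
  rcases lt_or_gt_of_ne hn₁' with hlt | hgt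
  · have : (n₁ : ℝ) ≤ -1 := by exact_mod_cast Int.le_sub_one_of_lt hlt
    linarith [hb1.1, hb1.2, hb2.1, hb2.2]
  · have : (1 : ℝ) ≤ n₁ := by exact_mod_cast hgt
    linarith [hb1.1, hb1.2, hb2.1, hb2.2]

/-- If the transforms of `p` and `q` never are simultaneously nonzero on a sufficiently fine
lattice, then one of `p`, `q` vanishes near the edge of the disk that supports them. -/
theorem ae_eq_zero_near_edge_of_lattice (hp : Continuous p) (hq : Continuous q) (hr : 0 < r)
    (hpr : ∀ ξ, p ξ ≠ 0 → ‖ξ‖ ≤ r) (hqr : ∀ ξ, q ξ ≠ 0 → ‖ξ‖ ≤ r)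
    {τ : Fin 2 → ℝ} (hτ : ∀ i, 0 < τ i) (hτr : 4 * r * τ 0 ≤ 1)
    (h : ∀ k : Fin 2 → ℤ,
      (∫ ξ, p ξ * Complex.exp
        (2 * Real.pi * Complex.I * (τ 0 * k 0 * ξ 0 + τ 1 * k 1 * ξ 1))) *
      (∫ ξ, q ξ * Complex.exp
        (2 * Real.pi * Complex.I * (τ 0 * k 0 * ξ 0 + τ 1 * k 1 * ξ 1))) = 0) :
    ∃ η > 0, (∀ᵐ ξ : EuclideanSpace ℝ (Fin 2), r - η < ξ 0 → p ξ = 0) ∨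
      (∀ᵐ ξ : EuclideanSpace ℝ (Fin 2), r - η < ξ 0 → q ξ = 0) := by
  have hKc := continuous_conv hp hq hqr
  have hKr := norm_le_of_conv_ne_zero hpr hqr
  obtain ⟨δ, hδ, hcap⟩ := exists_cap_eq_zero hKc hr hKr hτ hτr (fun k => by
    rw [integral_conv_mul hp hq hpr hqr (u := fun ζ => Complex.exp
      (2 * Real.pi * Complex.I * (τ 0 * k 0 * ζ 0 + τ 1 * k 1 * ζ 1))) (by fun_prop)]
    · exact h k
    · intro ξ η
      simp only [← Complex.exp_add, PiLp.add_apply]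
      congr 1; push_cast; ring)
  have hKi : Integrable (conv p q) :=
    hKc.integrable_of_hasCompactSupport (hasCompactSupport_of_norm_le hKr)
  have hcoord : ∀ {f : EuclideanSpace ℝ (Fin 2) → ℂ}, (∀ ξ, f ξ ≠ 0 → ‖ξ‖ ≤ r) →
      ∀ ξ, f ξ ≠ 0 → ξ 0 ≤ r := fun hf ξ hξ =>
    (le_abs_self _).trans ((PiLp.norm_apply_le ξ 0).trans (hf ξ hξ))
  have hπ := Real.pi_pos
  refine ae_eq_zero_of_edgeTransform_mul_le
    (hp.integrable_of_hasCompactSupport (hasCompactSupport_of_norm_le hpr))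
    (hq.integrable_of_hasCompactSupport (hasCompactSupport_of_norm_le hqr)) hpr hqr
    (hcoord hpr) (hcoord hqr) (N := ∫ ζ, ‖conv p q ζ‖) (δ := 2 * Real.pi * δ) (by positivity) ?_
  intro s z hz
  rw [edgeTransform_conv hp hq hpr hqr]
  have h1 := edgeTransform_sub_shift (conv p q) (2 * r) s δ z
  -- Moving the edge inwards by the width of the cap produces the factor of modulus `exp (-2πδ Im
  -- z)`.
  have h2 : edgeTransform (conv p q) (2 * r) s z = edgeTransform (conv p q) (2 * r - δ) s z *
      Complex.exp (2 * Real.pi * Complex.I * z * δ) := by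
    rw [h1, mul_assoc, ← Complex.exp_add]; simp
  rw [h2, norm_mul, Complex.norm_exp]
  have e : (2 * Real.pi * Complex.I * z * δ).re = -(2 * Real.pi * δ) * z.im := by
    simp; ring
  rw [e]
  gcongr
  exact norm_edgeTransform_le hKi fun ζ hζ => mul_nonneg hz (by linarith [hcap ζ hζ])

end SignRetrieval

/-! ### Exponentially decaying functions and the curvelet coefficients at scale one. -/

namespace SignRetrieval

theorem ExpDecay.integrable {d : ℕ} {f : EuclideanSpace ℝ (Fin d) → ℝ} (hf : ExpDecay f)
    (hm : AEStronglyMeasurable f) : Integrable f := by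
  obtain ⟨c, hc, hi⟩ := hf
  refine hi.mono' hm (Filter.Eventually.of_forall fun x => ?_)
  rw [Real.norm_eq_abs]
  exact le_mul_of_one_le_right (abs_nonneg _) (Real.one_le_exp (by positivity))

theorem ExpDecay.add {d : ℕ} {f h : EuclideanSpace ℝ (Fin d) → ℝ} (hf : ExpDecay f)
    (hh : ExpDecay h) (hfm : AEStronglyMeasurable f) (hhm : AEStronglyMeasurable h) :
    ExpDecay (fun x => f x + h x) := by
  obtain ⟨c, hc, hi⟩ := hf
  obtain ⟨c', hc', hi'⟩ := hh
  refine ⟨min c c', lt_min hc hc', (hi.add hi').mono'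
    ((hfm.add hhm).norm.mul (Continuous.aestronglyMeasurable (by fun_prop)))
    (Filter.Eventually.of_forall fun x => ?_)⟩
  rw [Real.norm_eq_abs, abs_of_nonneg (by positivity), Pi.add_apply]
  calc |f x + h x| * Real.exp (min c c' * ‖x‖)
      ≤ (|f x| + |h x|) * Real.exp (min c c' * ‖x‖) := by gcongr; exact abs_add_le _ _
    _ = |f x| * Real.exp (min c c' * ‖x‖) + |h x| * Real.exp (min c c' * ‖x‖) := by ring
    _ ≤ _ := by
        gcongr
        · exact min_le_left _ _
        · exact min_le_right _ _

theorem ExpDecay.neg {d : ℕ} {f : EuclideanSpace ℝ (Fin d) → ℝ} (hf : ExpDecay f) :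
    ExpDecay (fun x => -f x) := by
  obtain ⟨c, hc, hi⟩ := hf
  exact ⟨c, hc, by simpa using hi⟩

open Filter Topology in
/-- The Fourier transform of an exponentially decaying function is real-analytic: if it vanishes
near a point, it vanishes identically. -/
theorem ExpDecay.fourier_eq_zero {d : ℕ} {f : EuclideanSpace ℝ (Fin d) → ℝ} (hf : ExpDecay f)
    (hm : AEStronglyMeasurable f) {x₀ : EuclideanSpace ℝ (Fin d)}
    (h0 : ∀ᶠ ξ in 𝓝 x₀, 𝓕 (fun x => (f x : ℂ)) ξ = 0) (ξ : EuclideanSpace ℝ (Fin d)) :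
    𝓕 (fun x => (f x : ℂ)) ξ = 0 := by
  obtain ⟨c, hc, hi⟩ := hf
  set v := ξ - x₀ with hv
  have hmc : AEStronglyMeasurable (fun x => (f x : ℂ)) :=
    Complex.continuous_ofReal.comp_aestronglyMeasurable hm
  have hg : AEStronglyMeasurable (fun x => (f x : ℂ) *
      Complex.exp (((-2 * Real.pi * inner ℝ x x₀ : ℝ) : ℂ) * Complex.I)) :=
    hmc.mul (Continuous.aestronglyMeasurable (by fun_prop))
  have hL : AEMeasurable (fun x => inner ℝ x v) (volume : Measure (EuclideanSpace ℝ (Fin d))) :=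
    Measurable.aemeasurable (by fun_prop)
  -- Adding one keeps the strip width finite and positive when `v = 0`.
  have hv1 : 0 < ‖v‖ + 1 := by positivity
  have hint : Integrable (fun x => ‖(f x : ℂ) *
      Complex.exp (((-2 * Real.pi * inner ℝ x x₀ : ℝ) : ℂ) * Complex.I)‖ *
      Real.exp (c / (‖v‖ + 1) * |inner ℝ x v|)) := by
    refine hi.mono' (hg.norm.mul (Continuous.aestronglyMeasurable (by fun_prop)))
      (Filter.Eventually.of_forall fun x => ?_)
    rw [Real.norm_eq_abs, abs_of_nonneg (by positivity), norm_mul,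
      Complex.norm_exp_ofReal_mul_I, mul_one, Complex.norm_real, Real.norm_eq_abs]
    refine mul_le_mul_of_nonneg_left (Real.exp_le_exp.2 ?_) (abs_nonneg _)
    rw [div_mul_eq_mul_div, div_le_iff₀ hv1, mul_assoc]
    refine mul_le_mul_of_nonneg_left ((abs_real_inner_le_norm x v).trans ?_) hc.le
    nlinarith [norm_nonneg x]
  have hd := differentiableOn_integral_mul_cexp hg hL hint
  -- The Fourier transform along the line through `x₀` and `ξ`, continued to a strip around the
  -- imaginary axis; real parameters `0` and `1` give `x₀` and `ξ`.
  set G : ℂ → ℂ := fun z => ∫ x, (f x : ℂ) *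
      Complex.exp (((-2 * Real.pi * inner ℝ x x₀ : ℝ) : ℂ) * Complex.I) *
      Complex.exp (z * (inner ℝ x v : ℝ)) with hG
  set S : Set ℂ := {z : ℂ | |z.re| < c / (‖v‖ + 1)} with hS
  have hSo : IsOpen S := isOpen_lt (by fun_prop) continuous_const
  have hSc : IsPreconnected S := by
    have e : S = Complex.reCLM ⁻¹' Set.Ioo (-(c / (‖v‖ + 1))) (c / (‖v‖ + 1)) := by
      ext z; simp [hS, abs_lt]
    rw [e]
    exact ((convex_Ioo _ _).linear_preimage Complex.reCLM.toLinearMap).isPreconnected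
  have hmem : ∀ t : ℝ, (-2 * Real.pi * Complex.I * t : ℂ) ∈ S := by
    intro t
    have : (-2 * Real.pi * Complex.I * t : ℂ).re = 0 := by simp
    change |(-2 * Real.pi * Complex.I * t : ℂ).re| < c / (‖v‖ + 1)
    rw [this, abs_zero]; positivity
  have hGF : ∀ t : ℝ, G (-2 * Real.pi * Complex.I * t) = 𝓕 (fun x => (f x : ℂ)) (x₀ + t • v) := by
    intro t
    rw [Real.fourier_eq']
    refine integral_congr_ae (Filter.Eventually.of_forall fun x => ?_)
    simp only
    rw [smul_eq_mul, mul_assoc, ← Complex.exp_add, mul_comm]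
    congr 2
    rw [inner_add_right, inner_smul_right]
    push_cast; ring
  have hfreq : ∃ᶠ z in 𝓝[≠] (0 : ℂ), G z = 0 := by
    have htend : Tendsto (fun t : ℝ => (-2 * Real.pi * Complex.I * t : ℂ)) (𝓝[≠] 0) (𝓝[≠] 0) := by
      refine tendsto_nhdsWithin_iff.2 ⟨?_, ?_⟩
      · have : Continuous (fun t : ℝ => (-2 * Real.pi * Complex.I * t : ℂ)) := by fun_prop
        exact (this.tendsto' 0 0 (by simp)).mono_left nhdsWithin_le_nhds
      · filter_upwards [self_mem_nhdsWithin] with t ht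
        have ht' : t ≠ 0 := ht
        simp [ht', Real.pi_ne_zero]
    refine htend.frequently (Eventually.frequently ?_)
    have hc' : Tendsto (fun t : ℝ => x₀ + t • v) (𝓝[≠] 0) (𝓝 x₀) := by
      have : Continuous (fun t : ℝ => x₀ + t • v) := by fun_prop
      exact (this.tendsto' 0 x₀ (by simp)).mono_left nhdsWithin_le_nhds
    exact (hc'.eventually h0).mono fun t ht => by rw [hGF, ht]
  have hzero := (hd.analyticOnNhd hSo).eqOn_zero_of_preconnected_of_frequently_eq_zero hSc
    (show (0 : ℂ) ∈ S by simpa using hmem 0) hfreq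
  have h1 := hzero (hmem 1)
  rw [hGF, one_smul, hv, add_sub_cancel] at h1
  exact h1

variable {ν w : ℝ → ℝ} {χ₀ : EuclideanSpace ℝ (Fin 2) → ℝ} {α₁ α₂ : ℝ}

/-- The index of `γ^α_{1,0,k}`. -/
def indexOne (k : Fin 2 → ℤ) : Σ j : ℕ, Fin (2 ^ j) × ℤ × ℤ := ⟨1, (0, k 0, k 1)⟩

theorem curveletSystem_indexOne (k : Fin 2 → ℤ) (x : EuclideanSpace ℝ (Fin 2)) :
    curveletSystem ν w χ₀ α₁ α₂ (indexOne k) x =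
      generator ν w χ₀ 1 !₂[x 0 - α₁ / 4 * k 0, x 1 - α₂ / 2 * k 1] := by
  simp only [curveletSystem, curveletZero, indexOne, rotT]
  congr 2
  simp
  ring_nf
  trivial

/-- The coefficients at `j = 1`, `ℓ = 0` on the Fourier side. -/
theorem coeff_indexOne (h : IsCurveletTriple ν w χ₀) {f : EuclideanSpace ℝ (Fin 2) → ℝ}
    (hf : Integrable f) (k : Fin 2 → ℤ) :
    coeff f (curveletSystem ν w χ₀ α₁ α₂ (indexOne k)) =
      ∫ ξ, (𝓕 (fun x => (f x : ℂ)) ξ *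
        (((2 : ℝ) ^ (-(3 * ((1 : ℕ) : ℝ) / 2) - 5 / 2) * window ν w χ₀ 1 0 ξ : ℝ) : ℂ)) *
        Complex.exp (2 * Real.pi * Complex.I *
          ((α₁ / 4 : ℝ) * k 0 * ξ 0 + (α₂ / 2 : ℝ) * k 1 * ξ 1)) := by
  obtain ⟨r, -, -, hr, -⟩ := h.exists_outer_radius
  set χ : EuclideanSpace ℝ (Fin 2) → ℂ := fun ξ =>
    (((2 : ℝ) ^ (-(3 * ((1 : ℕ) : ℝ) / 2) - 5 / 2) * window ν w χ₀ 1 0 ξ : ℝ) : ℂ) with hχ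
  set e : EuclideanSpace ℝ (Fin 2) → ℂ := fun ξ => Complex.exp (2 * Real.pi * Complex.I *
          ((α₁ / 4 : ℝ) * k 0 * ξ 0 + (α₂ / 2 : ℝ) * k 1 * ξ 1)) with he
  have hχc : Continuous χ := by
    have := h.continuous_window_one
    rw [hχ]; fun_prop
  have hχs : HasCompactSupport χ := hasCompactSupport_of_norm_le (r := r) fun ξ hξ =>
    hr ξ fun h0 => hξ (by simp [hχ, h0])
  have hec : Continuous e := by rw [he]; fun_prop
  have hi : Integrable (fun ξ => χ ξ * e ξ) :=
    (hχc.mul hec).integrable_of_hasCompactSupport hχs.mul_right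
  have key := VectorFourier.integral_fourierIntegral_smul_eq_flip
    (L := innerₗ (EuclideanSpace ℝ (Fin 2))) (μ := volume) (ν := volume)
    Real.continuous_fourierChar continuous_inner (hf.ofReal (𝕜 := ℂ)) hi
  -- Translation of the generator is modulation of its window, and conjugation turns the inverse
  -- transform into the direct one; the multiplication formula `key` then applies.
  have hker : ∀ x, conj (curveletSystem ν w χ₀ α₁ α₂ (indexOne k) x)
      = 𝓕 (fun ξ => χ ξ * e ξ) x := by
    intro x
    rw [curveletSystem_indexOne, generator, Real.fourierInv_eq', ← integral_conj,
      Real.fourier_eq']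
    congr 1; ext ξ
    rw [smul_eq_mul, smul_eq_mul, map_mul, ← Complex.exp_conj, Complex.conj_ofReal]
    simp only [hχ, he]
    rw [mul_left_comm, ← Complex.exp_add, mul_comm]
    congr 2
    simp only [map_mul, Complex.conj_ofReal, Complex.conj_I, PiLp.inner_apply, Fin.sum_univ_two,
      RCLike.inner_apply, conj_trivial]
    simp
    ring
  unfold coeff
  simp only [hker]
  simp only [smul_eq_mul, flip_innerₗ] at key
  refine key.symm.trans ?_
  congr 1; ext ξ
  rw [← mul_assoc]
  rfl

theorem coeff_im {d : ℕ} {f : EuclideanSpace ℝ (Fin d) → ℝ} {φ : EuclideanSpace ℝ (Fin d) → ℂ}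
    (hφ : ∀ x, (φ x).im = 0) : (coeff f φ).im = 0 := by
  have : coeff f φ = ((∫ x, f x * (φ x).re : ℝ) : ℂ) := by
    refine Eq.trans ?_ (integral_ofReal (𝕜 := ℂ))
    unfold coeff
    congr 1; ext x
    rw [Complex.conj_eq_iff_im.2 (hφ x)]
    exact Complex.ext (by simp) (by simp [hφ x])
  rw [this, Complex.ofReal_im]

/-- Real numbers of equal modulus have equal squares. This is where the phaseless data become a
product of coefficients of `f - h` and `f + h`. -/
theorem sub_mul_add_eq_zero_of_norm_eq {a b : ℂ} (ha : a.im = 0) (hb : b.im = 0)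
    (hab : ‖a‖ = ‖b‖) : (a - b) * (a + b) = 0 := by
  have ha' : a = (a.re : ℂ) := Complex.ext (by simp) (by simp [ha])
  have hb' : b = (b.re : ℂ) := Complex.ext (by simp) (by simp [hb])
  rw [ha', hb', Complex.norm_real, Complex.norm_real, Real.norm_eq_abs, Real.norm_eq_abs] at hab
  have h2 := sq_eq_sq_iff_abs_eq_abs _ _ |>.2 hab
  rw [ha', hb']
  have : (a.re : ℂ) ^ 2 = (b.re : ℂ) ^ 2 := by exact_mod_cast h2
  linear_combination this

/-- The curvelet is bounded and continuous, being a transform of an integrable window. The lemma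
justifies splitting the coefficients of `f ± h`. -/
theorem integrable_mul_conj_curvelet (h : IsCurveletTriple ν w χ₀)
    {f : EuclideanSpace ℝ (Fin 2) → ℝ} (hf : Integrable f) (k : Fin 2 → ℤ) :
    Integrable (fun x => (f x : ℂ) * conj (curveletSystem ν w χ₀ α₁ α₂ (indexOne k) x)) := by
  obtain ⟨r, -, -, hr, -⟩ := h.exists_outer_radius
  set χ : EuclideanSpace ℝ (Fin 2) → ℂ := fun ξ =>
    (((2 : ℝ) ^ (-(3 * ((1 : ℕ) : ℝ) / 2) - 5 / 2) * window ν w χ₀ 1 0 ξ : ℝ) : ℂ) with hχ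
  have hχi : Integrable χ := by
    have := h.continuous_window_one
    refine Continuous.integrable_of_hasCompactSupport (by rw [hχ]; fun_prop)
      (hasCompactSupport_of_norm_le (r := r) fun ξ hξ => hr ξ fun h0 => hξ (by simp [hχ, h0]))
  have hFc : Continuous (𝓕 χ) :=
    VectorFourier.fourierIntegral_continuous Real.continuous_fourierChar
      (by exact continuous_inner) hχi
  have hgen : ∀ x, generator ν w χ₀ 1 x = 𝓕 χ (-x) := Real.fourierInv_eq_fourier_neg χ
  simp only [curveletSystem_indexOne, hgen]
  refine hf.ofReal.mul_bdd (c := ∫ ξ, ‖χ ξ‖) (Continuous.aestronglyMeasurable ?_)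
    (Filter.Eventually.of_forall fun x => ?_)
  · exact Complex.continuous_conj.comp (hFc.comp (by fun_prop))
  · rw [RCLike.norm_conj]
    exact VectorFourier.norm_fourierIntegral_le_integral_norm _ _ _ _ _

open Filter Topology in
/-- If the windowed spectrum of an exponentially decaying function vanishes near the outer edge of
the window, the function is zero. -/
theorem ExpDecay.ae_eq_zero_of_window {f : EuclideanSpace ℝ (Fin 2) → ℝ} (hf : ExpDecay f)
    (hm : AEStronglyMeasurable f) {χ : EuclideanSpace ℝ (Fin 2) → ℂ} (hχ : Continuous χ)
    {b t : ℝ} (ht : b < t) (hχt : χ (EuclideanSpace.single 0 t) ≠ 0)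
    (h : ∀ᵐ ξ : EuclideanSpace ℝ (Fin 2), b < ξ 0 → 𝓕 (fun x => (f x : ℂ)) ξ * χ ξ = 0) :
    ∀ᵐ x, f x = 0 := by
  have hi : Integrable (fun x => (f x : ℂ)) := (hf.integrable hm).ofReal
  have hFc : Continuous (𝓕 (fun x => (f x : ℂ))) :=
    VectorFourier.fourierIntegral_continuous Real.continuous_fourierChar
      (by exact continuous_inner) hi
  set V : Set (EuclideanSpace ℝ (Fin 2)) := {ξ | b < ξ 0} ∩ {ξ | χ ξ ≠ 0} with hV
  have hVo : IsOpen V := (isOpen_lt continuous_const (by fun_prop)).inter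
    (isOpen_ne_fun hχ continuous_const)
  have hVt : EuclideanSpace.single 0 t ∈ V := ⟨by simpa using ht, hχt⟩
  have hV0 : Set.EqOn (𝓕 (fun x => (f x : ℂ))) (fun _ => 0) V := by
    refine Measure.eqOn_open_of_ae_eq (μ := volume) ?_ hVo hFc.continuousOn continuousOn_const
    rw [Filter.EventuallyEq, ae_restrict_iff' hVo.measurableSet]
    filter_upwards [h] with ξ hξ hξV
    exact (mul_eq_zero.1 (hξ hξV.1)).resolve_right hξV.2
  have h0 := hf.fourier_eq_zero hm (x₀ := EuclideanSpace.single 0 t)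
    (Filter.eventually_of_mem (hVo.mem_nhds hVt) hV0)
  filter_upwards [ae_eq_zero_of_fourier_eq_zero hi h0] with x hx
  exact_mod_cast hx

end SignRetrieval

/-! ### Assembly of the sign retrieval theorem. -/

theorem theorem6p2 (ν w : ℝ → ℝ) (χ₀ : EuclideanSpace ℝ (Fin 2) → ℝ)
    (hwin : SignRetrieval.IsCurveletTriple ν w χ₀)
    (α₁ α₂ : ℝ) (hα₁ : 0 < α₁) (hα₂ : 0 < α₂)
    (hα₁' : α₁ ≤ 3 * 2 ^ (-5 : ℤ)) (hα₂' : α₂ ≤ 9 / (20 * Real.pi)) :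
    SignRetrieval.DoesSignRetrieval (SignRetrieval.curveletSystem ν w χ₀ α₁ α₂) := by
  open SignRetrieval in
  have him := curveletSystem_im hwin α₁ α₂
  refine ⟨him, fun f h hf2 hf hh2 hh hfh => ?_⟩
  have hfm := hf2.aestronglyMeasurable
  have hhm := hh2.aestronglyMeasurable
  have hfi := hf.integrable hfm
  have hhi := hh.integrable hhm
  have hsub : ExpDecay (fun x => f x + -h x) := hf.add hh.neg hfm hhm.neg
  have hadd : ExpDecay (fun x => f x + h x) := hf.add hh hfm hhm
  have hsubm : AEStronglyMeasurable (fun x => f x + -h x) := hfm.add hhm.neg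
  have haddm : AEStronglyMeasurable (fun x => f x + h x) := hfm.add hhm
  obtain ⟨r, hr0, hr, hχr, hedge⟩ := hwin.exists_outer_radius
  set χ : EuclideanSpace ℝ (Fin 2) → ℂ := fun ξ =>
    (((2 : ℝ) ^ (-(3 * ((1 : ℕ) : ℝ) / 2) - 5 / 2) * window ν w χ₀ 1 0 ξ : ℝ) : ℂ) with hχ
  have hχc : Continuous χ := by
    have := hwin.continuous_window_one
    rw [hχ]; fun_prop
  have hχ0 : ∀ ξ, χ ξ ≠ 0 ↔ window ν w χ₀ 1 0 ξ ≠ 0 := by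
    intro ξ
    have : (2 : ℝ) ^ (-(3 * ((1 : ℕ) : ℝ) / 2) - 5 / 2) ≠ 0 :=
      (Real.rpow_pos_of_pos two_pos _).ne'
    simp only [hχ, ne_eq, Complex.ofReal_eq_zero, mul_eq_zero, this, false_or]
  have hFc : ∀ {g : EuclideanSpace ℝ (Fin 2) → ℝ}, Integrable g →
      Continuous (𝓕 (fun x => (g x : ℂ))) := fun hg =>
    VectorFourier.fourierIntegral_continuous Real.continuous_fourierChar
      (by exact continuous_inner) hg.ofReal
  have hsupp : ∀ (F : EuclideanSpace ℝ (Fin 2) → ℂ) (ξ), F ξ * χ ξ ≠ 0 → ‖ξ‖ ≤ r :=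
    fun F ξ hξ => hχr ξ ((hχ0 ξ).1 (right_ne_zero_of_mul hξ))
  have hsubi := hsub.integrable hsubm
  have haddi := hadd.integrable haddm
  have hcadd : ∀ k, coeff (fun x => f x + h x) (curveletSystem ν w χ₀ α₁ α₂ (indexOne k))
      = coeff f (curveletSystem ν w χ₀ α₁ α₂ (indexOne k))
        + coeff h (curveletSystem ν w χ₀ α₁ α₂ (indexOne k)) := by
    intro k
    unfold coeff
    rw [← integral_add (integrable_mul_conj_curvelet hwin hfi k)
      (integrable_mul_conj_curvelet hwin hhi k)]
    congr 1; ext x; push_cast; ring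
  have hcsub : ∀ k, coeff (fun x => f x + -h x) (curveletSystem ν w χ₀ α₁ α₂ (indexOne k))
      = coeff f (curveletSystem ν w χ₀ α₁ α₂ (indexOne k))
        - coeff h (curveletSystem ν w χ₀ α₁ α₂ (indexOne k)) := by
    intro k
    unfold coeff
    rw [← integral_sub (integrable_mul_conj_curvelet hwin hfi k)
      (integrable_mul_conj_curvelet hwin hhi k)]
    congr 1; ext x; push_cast; ring
  obtain ⟨η, hη, hcase⟩ := ae_eq_zero_near_edge_of_lattice
    (p := fun ξ => 𝓕 (fun x => ((f x + -h x : ℝ) : ℂ)) ξ * χ ξ)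
    (q := fun ξ => 𝓕 (fun x => ((f x + h x : ℝ) : ℂ)) ξ * χ ξ)
    ((hFc hsubi).mul hχc) ((hFc haddi).mul hχc) hr0 (hsupp _) (hsupp _)
    (τ := ![α₁ / 4, α₂ / 2])
    (fun i => by fin_cases i <;> simp [hα₁, hα₂])
    (by
      -- The extreme case is sharp: `4 * (32 / 3) * ((3 / 32) / 4) = 1`.
      norm_num at hα₁'
      simp only [Matrix.cons_val_zero]
      nlinarith)
    (fun k => by
      have h1 := coeff_indexOne (α₁ := α₁) (α₂ := α₂) hwin hsubi k
      have h2 := coeff_indexOne (α₁ := α₁) (α₂ := α₂) hwin haddi k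
      simp only [Matrix.cons_val_zero, Matrix.cons_val_one]
      rw [← h1, ← h2, hcadd, hcsub]
      exact sub_mul_add_eq_zero_of_norm_eq (coeff_im (him _)) (coeff_im (him _)) (hfh _))
  -- A point of the first axis inside the vanishing strip at which the window is nonzero.
  obtain ⟨t, ht, hχt⟩ := hedge η hη
  rcases hcase with hc | hc
  · left
    filter_upwards [hsub.ae_eq_zero_of_window hsubm hχc ht ((hχ0 _).2 hχt) hc] with x hx
    linarith
  · right
    filter_upwards [hadd.ae_eq_zero_of_window haddm hχc ht ((hχ0 _).2 hχt) hc] with x hx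
    linarith
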